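/- Let $\Bbbk$ be a subfield of $\mathbb{C}$. For $n\ge 0$ let $$\mathcal A^*_n=\frac{\bigwedge^*_{\Bbbk}\big[\,a_{i,j}\;:\;i,j\in\{1,\dots,n\},\ i\neq j,\ a_{i,j}=a_{j,i}\,\big]}{\big(a_{i,j}a_{j,k}+a_{j,k}a_{k,i}+a_{k,i}a_{i,j}\;:\;i,j,k\text{ pairwise distinct}\big)}$$ be the Arnold algebra, graded with each $a_{i,j}$ in degree $1$, and let $\mathcal A^d_n$ be its $d$-th graded piece, on which the symmetric group $S_n$ acts by $\sigma\cdot a_{i,j}=a_{\sigma(i),\sigma(j)}$. For $r\ge 1$ and $\sigma\in S_n$ let $X_r(\sigma)$ be the number of $r$-cycles of $\sigma$ (with fixed points counted as $1$-cycles); a character polynomial $P\in\Bbbk[X_1,X_2,\dots]$ defines a class function $P_n$ on $S_n$ for every $n$. Write $\langle f,g\rangle_{S_n}=\frac1{n!}\sum_{\sigma\in S_n}f(\sigma)\overline{g(\sigma)}$, where a representation stands for its character. Then for every character polynomial $P$ the limit $\lim_{n\to\infty}\langle P_n,\mathcal A^d_n\rangle_{S_n}$ exists for each $d\ge 0$,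 and for every real number $q\ge 3$ the series $$\sum_{d=0}^{\infty}\frac{\lim_{n\to\infty}\langle P_n,\mathcal A^d_n\rangle_{S_n}}{q^d}$$ converges absolutely. -/

import Mathlib

open Filter Topology

/-- The index set of the generators: unordered pairs of distinct elements of `V`. -/
abbrev ArnoldPair (V : Type*) : Type _ := {e : Sym2 V // ¬ e.IsDiag}

/-- The action of a permutation of `V` on unordered pairs of distinct elements. -/
def ArnoldPair.perm {V : Type*} (σ : Equiv.Perm V) (e : ArnoldPair V) : ArnoldPair V :=
  ⟨Sym2.map σ e.1, fun h => e.2 ((Sym2.isDiag_map σ.injective).1 h)⟩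

noncomputable section

/-- The exterior algebra on the free module with basis the symbols `a_{i,j} = a_{j,i}`, `i ≠ j`. -/
abbrev ArnoldExterior (K V : Type*) [CommRing K] : Type _ :=
  ExteriorAlgebra K (ArnoldPair V →₀ K)

/-- The generator `a_{i,j}` of the exterior algebra. -/
def ArnoldExterior.gen (K : Type*) {V : Type*} [CommRing K] (i j : V) (h : i ≠ j) :
    ArnoldExterior K V :=
  ExteriorAlgebra.ι K (Finsupp.single (⟨s(i, j), fun hd => h (Sym2.mk_isDiag_iff.1 hd)⟩) 1)

/-- The Arnold relations `a_{i,j} a_{j,k} + a_{j,k} a_{k,i} + a_{k,i} a_{i,j} = 0`,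
for pairwise distinct `i, j, k`. -/
inductive ArnoldRel (K V : Type*) [CommRing K] : ArnoldExterior K V → ArnoldExterior K V → Prop
  | arnold (i j k : V) (hij : i ≠ j) (hjk : j ≠ k) (hki : k ≠ i) :
      ArnoldRel K V
        (ArnoldExterior.gen K i j hij * ArnoldExterior.gen K j k hjk
          + ArnoldExterior.gen K j k hjk * ArnoldExterior.gen K k i hki
          + ArnoldExterior.gen K k i hki * ArnoldExterior.gen K i j hij)
        0

/-- The Arnold algebra over `K` on the vertex set `V`: the quotient of the exterior algebra by the
two-sided ideal generated by the Arnold relations. -/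
abbrev ArnoldAlgebra (K V : Type*) [CommRing K] : Type _ := RingQuot (ArnoldRel K V)

namespace ArnoldAlgebra

variable (K : Type*) {V : Type*} [CommRing K]

/-- The quotient map from the exterior algebra. -/
def mk : ArnoldExterior K V →ₐ[K] ArnoldAlgebra K V :=
  RingQuot.mkAlgHom K (ArnoldRel K V)

/-- The algebra endomorphism of the exterior algebra with `a_{i,j} ↦ a_{σ i, σ j}`. -/
def permExterior (σ : Equiv.Perm V) : ArnoldExterior K V →ₐ[K] ArnoldExterior K V :=
  ExteriorAlgebra.map (Finsupp.lmapDomain K K (ArnoldPair.perm σ))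

theorem permExterior_gen (σ : Equiv.Perm V) (i j : V) (h : i ≠ j) :
    permExterior K σ (ArnoldExterior.gen K i j h)
      = ArnoldExterior.gen K (σ i) (σ j) (σ.injective.ne h) := by
  simp [permExterior, ArnoldExterior.gen, ArnoldPair.perm, Finsupp.mapDomain_single]

/-- The algebra endomorphism of the Arnold algebra with `a_{i,j} ↦ a_{σ i, σ j}`. -/
def permHom (σ : Equiv.Perm V) : ArnoldAlgebra K V →ₐ[K] ArnoldAlgebra K V :=
  RingQuot.liftAlgHom K ⟨(mk K).comp (permExterior K σ), by
    rintro _ _ ⟨i, j, k, hij, hjk, hki⟩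
    simp only [AlgHom.comp_apply, map_add, map_mul, permExterior_gen, map_zero]
    have h := RingQuot.mkAlgHom_rel K (ArnoldRel.arnold (K := K) (σ i) (σ j) (σ k)
      (σ.injective.ne hij) (σ.injective.ne hjk) (σ.injective.ne hki))
    simp only [map_add, map_mul, map_zero] at h
    exact h⟩

theorem permHom_mk (σ : Equiv.Perm V) (x : ArnoldExterior K V) :
    permHom K σ (mk K x) = mk K (permExterior K σ x) :=
  RingQuot.liftAlgHom_mkAlgHom_apply K _ _ x

theorem mk_surjective : Function.Surjective (mk K : ArnoldExterior K V → ArnoldAlgebra K V) :=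
  RingQuot.mkAlgHom_surjective K _

/-- The action of the permutations of `V` on the Arnold algebra. -/
def rep (V : Type*) : Representation K (Equiv.Perm V) (ArnoldAlgebra K V) where
  toFun σ := (permHom K σ).toLinearMap
  map_one' := by
    ext x
    obtain ⟨y, rfl⟩ := mk_surjective K x
    have h : (Finsupp.lmapDomain K K (ArnoldPair.perm (1 : Equiv.Perm V))) = LinearMap.id := by
      have : ArnoldPair.perm (1 : Equiv.Perm V) = id := by
        funext e
        simp [ArnoldPair.perm, Equiv.Perm.coe_one]
      rw [this, Finsupp.lmapDomain_id]
    simp [permHom_mk, permExterior, h]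
  map_mul' σ τ := by
    ext x
    obtain ⟨y, rfl⟩ := mk_surjective K x
    have h : (Finsupp.lmapDomain K K (ArnoldPair.perm (σ * τ)))
        = (Finsupp.lmapDomain K K (ArnoldPair.perm σ)).comp
          (Finsupp.lmapDomain K K (ArnoldPair.perm τ)) := by
      have : ArnoldPair.perm (σ * τ) = ArnoldPair.perm σ ∘ ArnoldPair.perm τ := by
        funext e
        simp [ArnoldPair.perm, Equiv.Perm.coe_mul, Sym2.map_map]
      rw [this, Finsupp.lmapDomain_comp]
    simp [permHom_mk, permExterior, h, ← ExteriorAlgebra.map_comp_map]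

/-- The `d`-th graded piece of the Arnold algebra: the image of the `d`-th exterior power. -/
def piece (V : Type*) (d : ℕ) : Submodule K (ArnoldAlgebra K V) :=
  (⋀[K]^d (ArnoldPair V →₀ K)).map (mk K).toLinearMap

theorem piece_le_comap (d : ℕ) (σ : Equiv.Perm V) :
    piece K V d ≤ (piece K V d).comap (rep K V σ) := by
  rintro _ ⟨x, hx, rfl⟩
  refine ⟨permExterior K σ x, ?_, (permHom_mk K σ x).symm⟩
  have h : ((⋀[K]^d (ArnoldPair V →₀ K)).map (permExterior K σ).toLinearMap)
      ≤ ⋀[K]^d (ArnoldPair V →₀ K) := by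
    rw [Submodule.map_pow]
    refine pow_le_pow_left' ?_ d
    rintro _ ⟨_, ⟨m, rfl⟩, rfl⟩
    exact ⟨_, (ExteriorAlgebra.map_apply_ι _ m).symm⟩
  exact h ⟨x, hx, rfl⟩

/-- The `d`-th graded piece of the Arnold algebra as a representation of the permutations of `V`. -/
def pieceRep (V : Type*) (d : ℕ) : Representation K (Equiv.Perm V) (piece K V d) :=
  (rep K V).subrepresentation (piece K V d) (piece_le_comap K d)

end ArnoldAlgebra

/-- `X_r(σ)`: the number of `r`-cycles of `σ`, where the fixed points are the `1`-cycles. -/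
def cycleCount {n : ℕ} (r : ℕ+) (σ : Equiv.Perm (Fin n)) : ℕ :=
  σ.partition.parts.count (r : ℕ)

/-- The class function `P_n` on `S_n` defined by a character polynomial `P ∈ K[X_1, X_2, …]`. -/
def charPolyFun {K : Type*} [CommRing K] (P : MvPolynomial ℕ+ K) (n : ℕ)
    (σ : Equiv.Perm (Fin n)) : K :=
  MvPolynomial.eval (fun r => (cycleCount r σ : K)) P

/-- The standard inner product of complex-valued class functions on a finite group. -/
def classInner {G : Type*} [Group G] [Fintype G] (f g : G → ℂ) : ℂ :=
  (Fintype.card G : ℂ)⁻¹ * ∑ x : G, f x * starRingEnd ℂ (g x)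

/-- `⟨P_n, A^d_n⟩_{S_n}`: the inner product of `P_n` with the character of the `d`-th graded
piece of the Arnold algebra on `{1, …, n}` over `K ⊆ ℂ`. -/
def arnoldInner (K : Subfield ℂ) (P : MvPolynomial ℕ+ K) (d n : ℕ) : ℂ :=
  classInner (fun σ : Equiv.Perm (Fin n) => ((charPolyFun P n σ : K) : ℂ))
    (fun σ => (((ArnoldAlgebra.pieceRep K (Fin n) d).character σ : K) : ℂ))

end

/-!
The functions `σ ↦ #{f : Y → [n] | σ ∘ f ∘ c = f}`, for permutations `c` of finite sets `Y`, span
the character polynomials: for `c` an `r`-cycle this is the number of fixed points of `σ ^ r`, and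
disjoint unions of permutations correspond to products. For such a function the inner product with
`A^d_n` is, up to conjugation, the trace of `c` on the coinvariants `(K[[n]^Y] ⊗ A^d_n)_{S_n}`.

A monomial of degree `d` and a labeling by `Y` involve at most `2d + |Y|` vertices, so from that
point on these coinvariants map onto each other as `n` grows. Their dimensions therefore stabilize,
and so do the traces, which gives the limits.

The Arnold relations rewrite each monomial in terms of disjoint unions of paths, whose `S_n`-orbits
are classified by the partitions of `d` into the numbers of edges of the paths. Hence the dimension
of the coinvariants at `n = 2d + |Y|` is at most `p(d) (2d + |Y|) ^ |Y|`. As `c` has finite order,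
this bounds the absolute value of its trace too, and since `p(d)` grows subexponentially the series
converges absolutely for all `q` with `|q| > 1`.
-/

section PermutationExtension

theorem exists_perm_map_eq {V : Type*} {l l' : List V} (hl : l.Nodup) (hl' : l'.Nodup)
    (h : l.length = l'.length) : ∃ σ : Equiv.Perm V, l.map σ = l' := by
  have := Equiv.Perm.isMultiplyPretransitive V l.length
  obtain ⟨σ, hσ⟩ := MulAction.exists_smul_eq (Equiv.Perm V)
    (⟨l.get, List.nodup_iff_injective_get.1 hl⟩ : Fin l.length ↪ V)
    ⟨l'.get ∘ Fin.cast h,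
      (List.nodup_iff_injective_get.1 hl').comp (Fin.cast_injective h)⟩
  refine ⟨σ, List.ext_get (by simpa using h) fun i h₁ h₂ => ?_⟩
  simpa using DFunLike.congr_fun hσ ⟨i, by simpa using h₁⟩

theorem exists_perm_comp_eq {X V W : Type*} [Finite X] [Finite V] (h : X → W) (g : V ↪ W)
    (hcard : Nat.card X ≤ Nat.card V) :
    ∃ (σ : Equiv.Perm W) (h' : X → V), ⇑σ ∘ g ∘ h' = h := by
  have hrange : Nat.card (Set.range h) ≤ Nat.card V :=
    (Finite.card_range_le h).trans hcard
  have := Equiv.Perm.isMultiplyPretransitive W (Nat.card (Set.range h))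
  let e := Finite.equivFin (Set.range h)
  let i : Fin (Nat.card (Set.range h)) ↪ V :=
    (Fin.castLEEmb hrange).trans (Finite.equivFin V).symm.toEmbedding
  obtain ⟨σ, hσ⟩ := MulAction.exists_smul_eq (Equiv.Perm W) (i.trans g)
    (e.symm.toEmbedding.trans (Function.Embedding.subtype _))
  refine ⟨σ, fun x => i (e ⟨h x, x, rfl⟩), funext fun x => ?_⟩
  have := DFunLike.congr_fun hσ (e ⟨h x, x, rfl⟩)
  rwa [Function.Embedding.trans_apply, Equiv.coe_toEmbedding, Equiv.symm_apply_apply] at this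

end PermutationExtension

section Trace

theorem pow_eq_one_of_hasEigenvalue {K U : Type*} [Field K] [AddCommGroup U] [Module K U]
    {T : Module.End K U} {k : ℕ} (hT : T ^ k = 1) {z : K} (hz : T.HasEigenvalue z) :
    z ^ k = 1 := by
  obtain ⟨v, hv⟩ := hz.exists_hasEigenvector
  have hvz : (z ^ k - 1) • v = 0 := by
    rw [sub_smul, one_smul, ← hv.pow_apply, hT, Module.End.one_apply, sub_self]
  exact sub_eq_zero.1 ((smul_eq_zero.1 hvz).resolve_right hv.2)

theorem norm_trace_le_finrank_of_pow_eq_one {U : Type*} [AddCommGroup U] [Module ℂ U]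
    [Module.Finite ℂ U] {T : Module.End ℂ U} {k : ℕ} (hk : k ≠ 0) (hT : T ^ k = 1) :
    ‖LinearMap.trace ℂ U T‖ ≤ Module.finrank ℂ U := by
  have hroots : ∀ x ∈ T.charpoly.roots.map norm, x ≤ 1 := by
    intro x hx
    obtain ⟨z, hz, rfl⟩ := Multiset.mem_map.1 hx
    have hz' : T.HasEigenvalue z :=
      (Module.End.hasEigenvalue_iff_isRoot_charpoly _ _).2 (Polynomial.mem_roots'.1 hz).2
    exact (Complex.norm_eq_one_of_pow_eq_one (pow_eq_one_of_hasEigenvalue hT hz') hk).le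
  calc ‖LinearMap.trace ℂ U T‖
      = ‖T.charpoly.roots.sum‖ := by
        rw [Module.End.trace_eq_sum_roots_charpoly_of_splits (IsAlgClosed.splits _)]
    _ ≤ (T.charpoly.roots.map norm).sum := norm_multiset_sum_le _
    _ ≤ (T.charpoly.roots.map norm).card • 1 := Multiset.sum_le_card_nsmul _ 1 hroots
    _ = T.charpoly.roots.card := by rw [Multiset.card_map, nsmul_eq_mul, mul_one]
    _ ≤ Module.finrank ℂ U := by
        rw [← LinearMap.charpoly_natDegree T]
        exact_mod_cast Polynomial.card_roots' _

theorem norm_algebraMap_trace_le_finrank {K U : Type*} [Field K] [Algebra K ℂ] [AddCommGroup U]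
    [Module K U] [Module.Finite K U] {T : Module.End K U} {k : ℕ} (hk : k ≠ 0) (hT : T ^ k = 1) :
    ‖algebraMap K ℂ (LinearMap.trace K U T)‖ ≤ Module.finrank K U := by
  have hT' : (T.baseChange ℂ : Module.End ℂ (TensorProduct K ℂ U)) ^ k = 1 := by
    rw [← LinearMap.baseChange_pow, hT]
    exact LinearMap.baseChange_id
  rw [← LinearMap.trace_baseChange, ← Module.finrank_baseChange (R := ℂ)]
  exact norm_trace_le_finrank_of_pow_eq_one hk hT'

theorem trace_eq_of_bijective {K U U' : Type*} [CommRing K] [AddCommGroup U] [Module K U]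
    [AddCommGroup U'] [Module K U'] {T : Module.End K U} {T' : Module.End K U'}
    {φ : U →ₗ[K] U'} (hφ : Function.Bijective φ) (hT : φ ∘ₗ T = T' ∘ₗ φ) :
    LinearMap.trace K U' T' = LinearMap.trace K U T := by
  rw [← LinearMap.trace_conj' T (LinearEquiv.ofBijective φ hφ)]
  congr 1
  ext x
  obtain ⟨y, rfl⟩ := (LinearEquiv.ofBijective φ hφ).surjective x
  rw [LinearEquiv.conj_apply_apply, LinearEquiv.symm_apply_apply]
  exact (LinearMap.congr_fun hT y).symm

section Sequence

variable {K : Type*} [Field K] {Q : ℕ → Type*} [∀ n, AddCommGroup (Q n)] [∀ n, Module K (Q n)]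
  [∀ n, Module.Finite K (Q n)] {φ : ∀ n, Q n →ₗ[K] Q (n + 1)}

theorem eventually_bijective_of_surjective (hφ : ∀ᶠ n in atTop, Function.Surjective (φ n)) :
    ∀ᶠ n in atTop, Function.Bijective (φ n) := by
  obtain ⟨a, ha⟩ := eventually_atTop.1 hφ
  have hanti : Antitone fun n => Module.finrank K (Q (a + n)) :=
    antitone_nat_of_succ_le fun n =>
      LinearMap.finrank_le_finrank_of_surjective (ha (a + n) (Nat.le_add_right a n))
  obtain ⟨m, hm⟩ := WellFoundedLT.antitone_chain_condition hanti
  filter_upwards [eventually_ge_atTop (a + m)] with n hn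
  obtain ⟨k, rfl⟩ := Nat.exists_eq_add_of_le ((Nat.le_add_right a m).trans hn)
  have hdim : Module.finrank K (Q (a + k)) = Module.finrank K (Q (a + k + 1)) :=
    (hm k (by lia)).symm.trans (hm (k + 1) (by lia))
  have hsurj := ha (a + k) (Nat.le_add_right a k)
  exact ⟨(LinearMap.injective_iff_surjective_of_finrank_eq_finrank hdim).2 hsurj, hsurj⟩

theorem eventuallyConst_trace {T : ∀ n, Module.End K (Q n)}
    (hT : ∀ n, φ n ∘ₗ T n = T (n + 1) ∘ₗ φ n)
    (hφ : ∀ᶠ n in atTop, Function.Surjective (φ n)) :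
    EventuallyConst (fun n => LinearMap.trace K (Q n) (T n)) atTop := by
  obtain ⟨b, hb⟩ := eventually_atTop.1 (eventually_bijective_of_surjective hφ)
  exact eventuallyConst_atTop_nat.2 ⟨b, fun n hn => trace_eq_of_bijective (hb n hn) (hT n)⟩

end Sequence

end Trace

section Coinvariants

open Representation

variable {K G H X X' M M' : Type*} [CommRing K] [Group G] [Group H] [MulAction G X] [MulAction H X']
  [AddCommGroup M] [Module K M] [AddCommGroup M'] [Module K M']

/-- The linear map `K[X] ⊗ M → K[X'] ⊗ M'` induced by maps of the two factors. The tensor product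
`K[X] ⊗ M` is realised on the finitely supported functions `X →₀ M`, with `Finsupp.single x m` in
the role of `x ⊗ m`. -/
noncomputable def finsuppMap (α : X → X') (φ : M →ₗ[K] M') : (X →₀ M) →ₗ[K] (X' →₀ M') :=
  Finsupp.lmapDomain M' K α ∘ₗ Finsupp.mapRange.linearMap φ

@[simp] theorem finsuppMap_single (α : X → X') (φ : M →ₗ[K] M') (x : X) (m : M) :
    finsuppMap α φ (Finsupp.single x m) = Finsupp.single (α x) (φ m) := by
  simp [finsuppMap]

theorem trace_finsuppMap [Finite X] [Module.Free K M] [Module.Finite K M]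
    (α : X → X) (φ : M →ₗ[K] M) :
    LinearMap.trace K (X →₀ M) (finsuppMap α φ)
      = Nat.card {x // α x = x} * LinearMap.trace K M φ := by
  classical
  have := Fintype.ofFinite X
  let b := Module.Free.chooseBasis K M
  rw [LinearMap.trace_eq_matrix_trace K (Finsupp.basis fun _ : X => b),
    LinearMap.trace_eq_matrix_trace K b, Matrix.trace, Fintype.sum_sigma, Matrix.trace,
    Nat.card_eq_fintype_card, Fintype.card_subtype, Finset.card_filter, Nat.cast_sum,
    Finset.sum_mul]
  refine Finset.sum_congr rfl fun x _ => ?_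
  simp only [Matrix.diag_apply, LinearMap.toMatrix_apply, Finsupp.coe_basis, finsuppMap_single,
    Finsupp.basis_repr, Finsupp.single_apply]
  split_ifs <;> simp

/-- The representation `K[X] ⊗ M` of `G`, for a `G`-set `X` and a representation `M` of `G`. -/
noncomputable def permTensor (X : Type*) [MulAction G X] (ρ : Representation K G M) :
    Representation K G (X →₀ M) where
  toFun g := finsuppMap (g • ·) (ρ g)
  map_one' := by ext; simp
  map_mul' g h := by ext; simp [mul_smul]

@[simp] theorem permTensor_apply (ρ : Representation K G M) (g : G) :
    permTensor X ρ g = finsuppMap (g • ·) (ρ g) := rfl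

/-- The coinvariants `(K[X] ⊗ M)_G`. -/
abbrev TensorCoinvariants (X : Type*) [MulAction G X] (ρ : Representation K G M) : Type _ :=
  (permTensor X ρ).Coinvariants

/-- The class of `x ⊗ m` in `(K[X] ⊗ M)_G`. -/
noncomputable def tensorMk (ρ : Representation K G M) (x : X) : M →ₗ[K] TensorCoinvariants X ρ :=
  Coinvariants.mk (permTensor X ρ) ∘ₗ Finsupp.lsingle x

theorem tensorMk_smul (ρ : Representation K G M) (g : G) (x : X) (m : M) :
    tensorMk ρ (g • x) (ρ g m) = tensorMk ρ x m := by
  simpa [tensorMk] using Coinvariants.mk_self_apply (permTensor X ρ) g (Finsupp.single x m)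

theorem tensorMk_apply_rep (ρ : Representation K G M) (g : G) (x : X) (m : M) :
    tensorMk ρ x (ρ g m) = tensorMk ρ (g⁻¹ • x) m := by
  rw [← tensorMk_smul ρ g (g⁻¹ • x), smul_inv_smul]

theorem tensorCoinvariants_hom_ext {ρ : Representation K G M} {N : Type*} [AddCommGroup N]
    [Module K N] {f f' : TensorCoinvariants X ρ →ₗ[K] N}
    (h : ∀ x m, f (tensorMk ρ x m) = f' (tensorMk ρ x m)) : f = f' := by
  ext x m
  exact h x m

theorem iSup_range_tensorMk (ρ : Representation K G M) :
    ⨆ x : X, (tensorMk ρ x).range = ⊤ := by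
  simp_rw [tensorMk, LinearMap.range_comp]
  rw [← Submodule.map_iSup, Finsupp.iSup_lsingle_range, Submodule.map_top,
    LinearMap.range_eq_top.2 (Coinvariants.mk_surjective _)]

section Map

variable {ρ : Representation K G M} {τ : Representation K H M'} {κ : G → H}

/-- The map `(K[X] ⊗ M)_G → (K[X'] ⊗ M')_H` induced by equivariant maps of the two factors. -/
noncomputable def tensorMap (α : X →ₑ[κ] X') (φ : M →ₗ[K] M')
    (hφ : ∀ g m, φ (ρ g m) = τ (κ g) (φ m)) :
    TensorCoinvariants X ρ →ₗ[K] TensorCoinvariants X' τ :=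
  Coinvariants.lift _ (Coinvariants.mk (permTensor X' τ) ∘ₗ finsuppMap α φ) fun g => by
    ext x m
    simpa [tensorMk, hφ, map_smulₛₗ] using tensorMk_smul τ (κ g) (α x) (φ m)

@[simp] theorem tensorMap_tensorMk (α : X →ₑ[κ] X') (φ : M →ₗ[K] M')
    (hφ : ∀ g m, φ (ρ g m) = τ (κ g) (φ m)) (x : X) (m : M) :
    tensorMap α φ hφ (tensorMk ρ x m) = tensorMk τ (α x) (φ m) := by
  simp [tensorMap, tensorMk]

end Map

variable (ρ : Representation K G M)

/-- The endomorphism of `(K[X] ⊗ M)_G` induced by an equivariant self-map of `X`. -/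
noncomputable def relabel (c : X →[G] X) : Module.End K (TensorCoinvariants X ρ) :=
  tensorMap c LinearMap.id fun _ _ => rfl

@[simp] theorem relabel_tensorMk (c : X →[G] X) (x : X) (m : M) :
    relabel ρ c (tensorMk ρ x m) = tensorMk ρ (c x) m :=
  tensorMap_tensorMk c LinearMap.id _ x m

theorem relabel_pow_eq_one {c : X →[G] X} {k : ℕ} (hc : c^[k] = id) : relabel ρ c ^ k = 1 := by
  have hpow : ∀ j x m, (relabel ρ c ^ j) (tensorMk ρ x m) = tensorMk ρ (c^[j] x) m := by
    intro j x m
    induction j with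
    | zero => rfl
    | succ j ih => rw [pow_succ', Module.End.mul_apply, ih, relabel_tensorMk,
        Function.iterate_succ_apply']
  refine tensorCoinvariants_hom_ext fun x m => ?_
  rw [hpow, hc, id_eq, Module.End.one_apply]

theorem finrank_tensorCoinvariants_le [Nontrivial K] [Finite X] {ι : Type*} [Finite ι] {u : ι → M}
    (hu : Submodule.span K (Set.range fun p : G × ι => ρ p.1 (u p.2)) = ⊤) :
    Module.finrank K (TensorCoinvariants X ρ) ≤ Nat.card ι * Nat.card X := by
  have := Fintype.ofFinite ι
  have := Fintype.ofFinite X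
  have hspan : Submodule.span K (Set.range fun p : ι × X => tensorMk ρ p.2 (u p.1)) = ⊤ := by
    rw [eq_top_iff, ← iSup_range_tensorMk, iSup_le_iff]
    intro x
    rw [LinearMap.range_eq_map, ← hu, Submodule.map_span, Submodule.span_le]
    rintro _ ⟨_, ⟨⟨g, i⟩, rfl⟩, rfl⟩
    rw [tensorMk_apply_rep]
    exact Submodule.subset_span ⟨(i, g⁻¹ • x), rfl⟩
  simpa using finrank_le_of_span_eq_top hspan

theorem finrank_tensorCoinvariants_le_of_type [Nontrivial K] [Finite X] {ι P : Type*} [Finite P]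
    {u : ι → M} (hu : Submodule.span K (Set.range u) = ⊤) (type : ι → P)
    (htype : ∀ i j, type i = type j → ∃ g, u j ∈ Submodule.span K {ρ g (u i)}) :
    Module.finrank K (TensorCoinvariants X ρ) ≤ Nat.card P * Nat.card X := by
  let v : Set.range type → M := fun p => u (Set.rangeSplitting type p)
  have hspan : Submodule.span K (Set.range fun p : G × Set.range type =>
      ρ p.1 (v p.2)) = ⊤ := by
    rw [eq_top_iff, ← hu, Submodule.span_le]
    rintro _ ⟨j, rfl⟩
    let p : Set.range type := ⟨type j, j, rfl⟩
    obtain ⟨g, hg⟩ := htype _ j (Set.apply_rangeSplitting type p)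
    refine Submodule.span_mono ?_ hg
    rintro _ rfl
    exact ⟨(g, p), rfl⟩
  refine (finrank_tensorCoinvariants_le ρ hspan).trans ?_
  gcongr
  exact Finite.card_subtype_le _

end Coinvariants

section CoinvariantsTrace

open Representation

variable {K G X M : Type*} [Field K] [CharZero K] [Group G] [Fintype G] [AddCommGroup M]
  [Module K M] [Module.Finite K M]

theorem trace_eq_of_comp_coinvariants_mk {ρ : Representation K G M}
    {S : Module.End K ρ.Coinvariants} {T : Module.End K M}
    (h : S ∘ₗ Coinvariants.mk ρ = Coinvariants.mk ρ ∘ₗ T) :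
    LinearMap.trace K ρ.Coinvariants S
      = (Fintype.card G : K)⁻¹ * ∑ g, LinearMap.trace K M (ρ g ∘ₗ T) := by
  let average : M →ₗ[K] M := (Fintype.card G : K)⁻¹ • ∑ g, ρ g
  have haverage : ∀ g, average ∘ₗ ρ g = average := by
    intro g
    ext m
    simp only [average, LinearMap.comp_apply, LinearMap.smul_apply, LinearMap.sum_apply]
    congr 1
    exact Fintype.sum_equiv (Equiv.mulRight g) _ _ fun _ => by simp
  let s : ρ.Coinvariants →ₗ[K] M := Coinvariants.lift ρ average haverage
  have hs : Coinvariants.mk ρ ∘ₗ s = LinearMap.id := by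
    ext m
    simp [s, average, ← Nat.cast_smul_eq_nsmul K, smul_smul]
  have hS : S = (Coinvariants.mk ρ ∘ₗ T) ∘ₗ s := by
    rw [← h, LinearMap.comp_assoc, hs, LinearMap.comp_id]
  have hsum : (∑ g, ρ g) ∘ₗ T = ∑ g, ρ g ∘ₗ T := by
    ext m
    simp
  rw [hS, LinearMap.trace_comp_comm', ← LinearMap.comp_assoc, Coinvariants.lift_comp_mk,
    LinearMap.smul_comp, hsum, map_smul, map_sum, smul_eq_mul]

theorem trace_relabel [MulAction G X] [Finite X] (ρ : Representation K G M) (c : X →[G] X) :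
    LinearMap.trace K (TensorCoinvariants X ρ) (relabel ρ c)
      = (Fintype.card G : K)⁻¹ * ∑ g, Nat.card {x // g • c x = x} * ρ.character g := by
  have hlift : relabel ρ c ∘ₗ Coinvariants.mk (permTensor X ρ)
      = Coinvariants.mk (permTensor X ρ) ∘ₗ finsuppMap c LinearMap.id := by
    ext x m
    exact (relabel_tensorMk ρ c x m).trans (by simp [tensorMk])
  have hcomp : ∀ g, permTensor X ρ g ∘ₗ finsuppMap c LinearMap.id
      = finsuppMap (fun x => g • c x) (ρ g) := by
    intro g
    ext x m : 2
    simp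
  simp_rw [trace_eq_of_comp_coinvariants_mk hlift, hcomp, trace_finsuppMap, character]

end CoinvariantsTrace

section CycleCounts

open Function Equiv.Perm

variable {V : Type*} [Fintype V] [DecidableEq V] (σ : Equiv.Perm V)

theorem minimalPeriod_eq_card_support_cycleOf {x : V} (hx : x ∈ σ.support) :
    minimalPeriod σ x = (σ.cycleOf x).support.card := by
  refine Nat.dvd_right_iff_eq.1 fun k => ?_
  rw [← isPeriodicPt_iff_minimalPeriod_dvd, IsPeriodicPt, IsFixedPt, iterate_eq_pow,
    isCycleOn_support_cycleOf σ x |>.pow_apply_eq (mem_support_cycleOf_iff.2 ⟨.refl σ x, hx⟩)]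

theorem card_minimalPeriod_eq_one :
    (Finset.univ.filter fun x => minimalPeriod σ x = 1).card = σ.partition.parts.count 1 := by
  have hone : 1 ∉ σ.cycleType := fun h => (one_lt_of_mem_cycleType h).ne rfl
  rw [parts_partition, Multiset.count_add, Multiset.count_eq_zero_of_notMem hone,
    Multiset.count_replicate_self, zero_add, ← Finset.card_compl]
  congr 1
  ext x
  simp [minimalPeriod_eq_one_iff_isFixedPt, IsFixedPt]

theorem card_minimalPeriod_eq_of_ne_one {s : ℕ} (hs : s ≠ 1) :
    (Finset.univ.filter fun x => minimalPeriod σ x = s).card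
      = s * σ.partition.parts.count s := by
  have hsupport : ∀ x, minimalPeriod σ x = s → x ∈ σ.support := by
    rintro x rfl
    exact mem_support.2 fun hx => hs (minimalPeriod_eq_one_iff_isFixedPt.2 hx)
  let F := σ.cycleFactorsFinset.filter fun τ => τ.support.card = s
  have hcount : σ.partition.parts.count s = F.card := by
    rw [parts_partition, Multiset.count_add, Multiset.count_replicate, if_neg (Ne.symm hs),
      add_zero, cycleType_def, Multiset.count_map]
    simp only [Function.comp_apply, eq_comm, F]
    rfl
  have hmaps : ∀ x ∈ Finset.univ.filter fun x => minimalPeriod σ x = s, σ.cycleOf x ∈ F := by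
    intro x hx
    have hx' := (Finset.mem_filter.1 hx).2
    exact Finset.mem_filter.2 ⟨cycleOf_mem_cycleFactorsFinset_iff.2 (hsupport x hx'),
      (minimalPeriod_eq_card_support_cycleOf σ (hsupport x hx')).symm.trans hx'⟩
  have hfiber : ∀ τ ∈ F, ((Finset.univ.filter fun x => minimalPeriod σ x = s).filter
      fun x => σ.cycleOf x = τ).card = s := by
    intro τ hτ
    obtain ⟨hτσ, rfl⟩ := Finset.mem_filter.1 hτ
    congr 1
    ext x
    simp only [Finset.mem_filter, Finset.mem_univ, true_and]
    constructor
    · rintro ⟨hx, rfl⟩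
      exact mem_support_cycleOf_iff.2 ⟨.refl σ x, hsupport x hx⟩
    · intro hx
      obtain rfl := cycle_is_cycleOf hx hτσ
      exact ⟨minimalPeriod_eq_card_support_cycleOf σ
        (mem_cycleFactorsFinset_support_le hτσ hx), rfl⟩
  rw [Finset.card_eq_sum_card_fiberwise hmaps, Finset.sum_congr rfl hfiber, Finset.sum_const,
    hcount, smul_eq_mul, mul_comm]

theorem card_minimalPeriod_eq (s : ℕ) :
    (Finset.univ.filter fun x => minimalPeriod σ x = s).card
      = s * σ.partition.parts.count s := by
  obtain rfl | hs := eq_or_ne s 1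
  · rw [card_minimalPeriod_eq_one, one_mul]
  · exact card_minimalPeriod_eq_of_ne_one σ hs

theorem card_pow_fixed_eq_sum {r : ℕ} (hr : r ≠ 0) :
    Nat.card {x // (σ ^ r) x = x} = ∑ s ∈ r.divisors, s * σ.partition.parts.count s := by
  have hperiod : ∀ x, (σ ^ r) x = x ↔ minimalPeriod σ x ∈ r.divisors := by
    intro x
    rw [← iterate_eq_pow, Nat.mem_divisors, and_iff_left hr, ← isPeriodicPt_iff_minimalPeriod_dvd]
    rfl
  rw [Nat.card_eq_fintype_card, Fintype.card_subtype, Finset.card_eq_sum_card_fiberwise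
    (t := r.divisors) (f := minimalPeriod σ) fun x hx => (hperiod x).1 (Finset.mem_filter.1 hx).2]
  refine Finset.sum_congr rfl fun s hs => ?_
  rw [← card_minimalPeriod_eq, Finset.filter_filter]
  congr 1
  ext x
  simp only [hperiod, Finset.mem_filter, Finset.mem_univ, true_and]
  exact and_iff_right_of_imp fun h => h ▸ hs

end CycleCounts

section Labelings

variable {V W Y Z : Type*}

/-- Precomposition with a self-map of the labels, on the `V`-valued labelings `Y → V`. -/
def precomp (V : Type*) (c : Y → Y) : (Y → V) →[Equiv.Perm V] (Y → V) where
  toFun f := f ∘ c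
  map_smul' _ _ := rfl

/-- Postcomposition of labelings `Y → V` with an embedding `V ↪ W`. -/
noncomputable def postcomp (Y : Type*) (g : V ↪ W) :
    (Y → V) →ₑ[fun σ : Equiv.Perm V => σ.viaEmbedding g] (Y → W) where
  toFun f := g ∘ f
  map_smul' σ f := funext fun y => (Equiv.Perm.viaEmbedding_apply σ g (f y)).symm

@[simp] theorem precomp_apply (c : Y → Y) (f : Y → V) : precomp V c f = f ∘ c := rfl

@[simp] theorem postcomp_apply (g : V ↪ W) (f : Y → V) : postcomp Y g f = g ∘ f := rfl

theorem iterate_precomp (c : Y → Y) (k : ℕ) (f : Y → V) :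
    (precomp V c)^[k] f = f ∘ c^[k] := by
  induction k with
  | zero => rfl
  | succ k ih => rw [Function.iterate_succ_apply', ih, precomp_apply, Function.comp_assoc,
      ← Function.iterate_succ]

/-- The number of labelings `f : Y → V` fixed by the pair `(c, σ)`, acting by
`f ↦ σ ∘ f ∘ c`. -/
noncomputable def labelFix (c : Y → Y) (σ : Equiv.Perm V) : ℕ :=
  Nat.card {f : Y → V // σ ∘ f ∘ c = f}

theorem labelFix_conj (e : Y ≃ Z) (c : Y → Y) (σ : Equiv.Perm V) :
    labelFix (e ∘ c ∘ e.symm) σ = labelFix c σ := by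
  refine (Nat.card_congr ((Equiv.arrowCongr e (Equiv.refl V)).subtypeEquiv fun f => ?_)).symm
  simp [funext_iff, ← e.forall_congr_right (q := fun z => σ (f (c (e.symm z))) = _)]

theorem labelFix_sumMap (c : Y → Y) (c' : Z → Z) (σ : Equiv.Perm V) :
    labelFix (Sum.map c c') σ = labelFix c σ * labelFix c' σ := by
  rw [labelFix, labelFix, labelFix, ← Nat.card_prod]
  refine Nat.card_congr (((Equiv.sumArrowEquivProdArrow Y Z V).subtypeEquiv fun f => ?_).trans
    (Equiv.subtypeProdEquivProd (p := fun f : Y → V => σ ∘ f ∘ c = f)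
      (q := fun f : Z → V => σ ∘ f ∘ c' = f)))
  simp [funext_iff]

theorem labelFix_of_isEmpty [IsEmpty Y] (c : Y → Y) (σ : Equiv.Perm V) : labelFix c σ = 1 :=
  Nat.card_eq_one_iff_unique.2
    ⟨⟨fun _ _ => Subtype.ext (Subsingleton.elim _ _)⟩, ⟨isEmptyElim, Subsingleton.elim _ _⟩⟩

theorem pow_apply_label_iterate {c : Y → Y} {σ : Equiv.Perm V} {f : Y → V} (hf : σ ∘ f ∘ c = f)
    (k : ℕ) (y : Y) : (σ ^ k) (f (c^[k] y)) = f y := by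
  induction k generalizing y with
  | zero => rfl
  | succ k ih =>
    rw [pow_succ', Equiv.Perm.mul_apply, Function.iterate_succ_apply, ih]
    exact congrFun hf y

theorem labelFix_zmod_add_one (r : ℕ) [NeZero r] (σ : Equiv.Perm V) :
    labelFix (fun i : ZMod r => i + 1) σ = Nat.card {x // (σ ^ r) x = x} := by
  have hiterate : ∀ (k : ℕ) (i : ZMod r), (fun i : ZMod r => i + 1)^[k] i = i + k := by
    simp [add_right_iterate_apply]
  refine Nat.card_eq_of_bijective (fun f => ⟨f.1 0, ?_⟩) ⟨?_, ?_⟩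
  · simpa [hiterate] using pow_apply_label_iterate f.2 r 0
  · rintro ⟨f, hf⟩ ⟨f', hf'⟩ hff'
    have hzero : f 0 = f' 0 := by simpa using hff'
    refine Subtype.ext (funext fun i => ?_)
    have h := pow_apply_label_iterate hf (-i).val i
    have h' := pow_apply_label_iterate hf' (-i).val i
    rw [hiterate, ZMod.natCast_zmod_val, add_neg_cancel] at h h'
    exact h.symm.trans ((congrArg _ hzero).trans h')
  · rintro ⟨x, hx⟩
    refine ⟨⟨fun i => (σ ^ (-i).val) x, funext fun i => ?_⟩, by simp⟩
    have hperiodic : Function.IsPeriodicPt σ r x := by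
      rwa [Function.IsPeriodicPt, Equiv.Perm.iterate_eq_pow]
    have hval : (-i).val = ((-(i + 1)).val + 1) % r := by
      rw [← ZMod.val_natCast]
      congr 1
      simp
    simp only [Function.comp_apply]
    rw [hval, ← Equiv.Perm.mul_apply, ← pow_succ', ← Equiv.Perm.iterate_eq_pow,
      ← Equiv.Perm.iterate_eq_pow, hperiodic.iterate_mod_apply]

end Labelings

section CharacterPolynomials

variable (K : Type*) [Field K]

/-- The families of functions on the symmetric groups `S_n`, `n ≥ 0`, spanned by the numbers of
labelings fixed by a permutation of a finite set of labels. They contain the character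
polynomials, and pair well with representations. -/
def labelSpan : Submodule K (∀ n : ℕ, Equiv.Perm (Fin n) → K) :=
  Submodule.span K (Set.range fun kc : (Σ k : ℕ, Equiv.Perm (Fin k)) =>
    fun _ σ => (labelFix kc.2 σ : K))

theorem labelFix_mem_labelSpan {Y : Type*} [Finite Y] (c : Equiv.Perm Y) :
    (fun _ σ => (labelFix c σ : K)) ∈ labelSpan K := by
  refine Submodule.subset_span ⟨⟨Nat.card Y, (Finite.equivFin Y).permCongr c⟩, ?_⟩
  exact funext₂ fun n σ => congrArg Nat.cast (labelFix_conj (Finite.equivFin Y) c σ)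

theorem mul_mem_labelSpan {F G : ∀ n : ℕ, Equiv.Perm (Fin n) → K} (hF : F ∈ labelSpan K)
    (hG : G ∈ labelSpan K) : F * G ∈ labelSpan K := by
  suffices h : labelSpan K * labelSpan K ≤ labelSpan K from h (Submodule.mul_mem_mul hF hG)
  conv_lhs => rw [labelSpan, Submodule.span_mul_span]
  rw [Submodule.span_le]
  rintro _ ⟨_, ⟨⟨k, c⟩, rfl⟩, _, ⟨⟨k', c'⟩, rfl⟩, rfl⟩
  convert! labelFix_mem_labelSpan K (Equiv.Perm.sumCongr c c') using 1
  exact funext₂ fun n σ => ((congrArg Nat.cast (labelFix_sumMap c c' σ)).trans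
    (Nat.cast_mul _ _)).symm

theorem one_mem_labelSpan : 1 ∈ labelSpan K := by
  convert! labelFix_mem_labelSpan K (1 : Equiv.Perm Empty) using 1
  funext n σ
  simp [labelFix_of_isEmpty]

theorem count_mem_labelSpan [CharZero K] {r : ℕ} (hr : r ≠ 0) :
    (fun _ σ => (σ.partition.parts.count r : K)) ∈ labelSpan K := by
  induction r using Nat.strong_induction_on with
  | _ r ih =>
    let X (s : ℕ) : ∀ n : ℕ, Equiv.Perm (Fin n) → K := fun _ σ => σ.partition.parts.count s
    have : NeZero r := ⟨hr⟩
    have hfixed := labelFix_mem_labelSpan K (Equiv.addRight (1 : ZMod r))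
    have hproper : ∑ s ∈ r.properDivisors, (s : K) • X s ∈ labelSpan K :=
      Submodule.sum_mem _ fun s hs => Submodule.smul_mem _ _
        (ih s (Nat.mem_properDivisors.1 hs).2 (Nat.pos_of_mem_properDivisors hs).ne')
    convert! Submodule.smul_mem _ (r : K)⁻¹ (Submodule.sub_mem _ hfixed hproper) using 1
    funext n σ
    simp only [X, Pi.smul_apply, Pi.sub_apply, Finset.sum_apply, smul_eq_mul, Equiv.coe_addRight]
    rw [labelFix_zmod_add_one, card_pow_fixed_eq_sum σ hr, ← Nat.insert_self_properDivisors hr,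
      Finset.sum_insert Nat.self_notMem_properDivisors]
    have : (r : K) ≠ 0 := Nat.cast_ne_zero.2 hr
    field_simp
    push_cast
    ring

theorem charPolyFun_mem_labelSpan [CharZero K] (P : MvPolynomial ℕ+ K) :
    charPolyFun P ∈ labelSpan K := by
  induction P using MvPolynomial.induction_on with
  | C a =>
    convert! Submodule.smul_mem _ a (one_mem_labelSpan K) using 1
    funext n σ
    simp [charPolyFun]
  | add p q hp hq =>
    convert! Submodule.add_mem _ hp hq using 1
    funext n σ
    simp [charPolyFun]
  | mul_X p r hp =>
    convert! mul_mem_labelSpan K hp (count_mem_labelSpan K r.ne_zero) using 1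
    funext n σ
    simp [charPolyFun, cycleCount]

end CharacterPolynomials

section PartitionGrowth

theorem sum_count_parts_mul {n : ℕ} (p : n.Partition) :
    ∑ k ∈ Finset.Icc 1 n, p.parts.count k * k = n := by
  have hsubset : p.parts.toFinset ⊆ Finset.Icc 1 n := by
    intro k hk
    rw [Multiset.mem_toFinset] at hk
    exact Finset.mem_Icc.2 ⟨p.parts_pos hk, p.le_of_mem_parts hk⟩
  exact (Finset.sum_multiset_count_of_subset p.parts _ hsubset).symm.trans p.parts_sum

theorem count_parts_le {n : ℕ} (p : n.Partition) {k : ℕ} (hk : k ∈ Finset.Icc 1 n) :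
    p.parts.count k ≤ n :=
  calc p.parts.count k
      ≤ p.parts.count k * k := Nat.le_mul_of_pos_right _ (Finset.mem_Icc.1 hk).1
    _ ≤ ∑ k ∈ Finset.Icc 1 n, p.parts.count k * k :=
        Finset.single_le_sum (f := fun k => p.parts.count k * k) (fun _ _ => Nat.zero_le _) hk
    _ = n := sum_count_parts_mul p

theorem partition_eq_of_count_eq {n : ℕ} {p p' : n.Partition}
    (h : ∀ k ∈ Finset.Icc 1 n, p.parts.count k = p'.parts.count k) : p = p' := by
  refine Nat.Partition.ext (Multiset.ext.2 fun k => ?_)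
  by_cases hk : k ∈ Finset.Icc 1 n
  · exact h k hk
  · have hzero (p : n.Partition) : p.parts.count k = 0 := Multiset.count_eq_zero_of_notMem
      fun hmem => hk (Finset.mem_Icc.2 ⟨p.parts_pos hmem, p.le_of_mem_parts hmem⟩)
    rw [hzero, hzero]

theorem card_partition_mul_pow_le_prod (n : ℕ) {x : ℝ} (hx : 0 ≤ x) :
    Fintype.card n.Partition * x ^ n
      ≤ ∏ k ∈ Finset.Icc 1 n, ∑ m ∈ Finset.range (n + 1), (x ^ k) ^ m := by
  have hweight : ∀ p : n.Partition,
      ∏ k : Finset.Icc 1 n, (x ^ k.1) ^ p.parts.count k.1 = x ^ n := by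
    intro p
    simp_rw [← pow_mul, mul_comm _ (p.parts.count _)]
    rw [Finset.prod_pow_eq_pow_sum, Finset.sum_coe_sort (Finset.Icc 1 n)
      fun k => p.parts.count k * k, sum_count_parts_mul]
  have hinj : Function.Injective
      fun (p : n.Partition) (k : Finset.Icc 1 n) => p.parts.count k.1 := fun p p' h =>
    partition_eq_of_count_eq fun k hk => congrFun h ⟨k, hk⟩
  have hsubset : Finset.univ.map ⟨_, hinj⟩
      ⊆ Fintype.piFinset fun _ : Finset.Icc 1 n => Finset.range (n + 1) := by
    intro f hf
    obtain ⟨p, -, rfl⟩ := Finset.mem_map.1 hf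
    exact Fintype.mem_piFinset.2 fun k => Finset.mem_range_succ_iff.2 (count_parts_le p k.2)
  rw [← Finset.prod_coe_sort, Finset.prod_univ_sum]
  calc (Fintype.card n.Partition : ℝ) * x ^ n
      = ∑ p : n.Partition, ∏ k : Finset.Icc 1 n, (x ^ k.1) ^ p.parts.count k.1 := by
        rw [Finset.sum_congr rfl fun p _ => hweight p, Finset.sum_const, nsmul_eq_mul,
          Finset.card_univ]
    _ = ∑ f ∈ Finset.univ.map ⟨_, hinj⟩, ∏ k : Finset.Icc 1 n, (x ^ k.1) ^ f k := by
        rw [Finset.sum_map, Function.Embedding.coeFn_mk]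
    _ ≤ _ := Finset.sum_le_sum_of_subset_of_nonneg hsubset fun f _ _ =>
        Finset.prod_nonneg fun _ _ => by positivity

theorem geom_sum_range_le_exp {x y : ℝ} (hy : 0 ≤ y) (hyx : y ≤ x) (hx : x < 1) (n : ℕ) :
    ∑ m ∈ Finset.range n, y ^ m ≤ Real.exp (y / (1 - x)) := by
  have hy' : 0 < 1 - y := sub_pos.2 (hyx.trans_lt hx)
  have hx' : 0 < 1 - x := sub_pos.2 hx
  calc ∑ m ∈ Finset.range n, y ^ m
      ≤ y ^ 0 / (1 - y) := by
        simpa only [Finset.range_eq_Ico] using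
          geom_sum_Ico_le_of_lt_one (m := 0) (n := n) hy (hyx.trans_lt hx)
    _ = y / (1 - y) + 1 := by
        field_simp
        ring
    _ ≤ y / (1 - x) + 1 :=
        add_le_add_left (div_le_div_of_nonneg_left hy hx' (sub_le_sub_left hyx 1)) 1
    _ ≤ Real.exp (y / (1 - x)) := Real.add_one_le_exp _

theorem card_partition_mul_pow_le (n : ℕ) {x : ℝ} (hx : 0 ≤ x) (hx' : x < 1) :
    Fintype.card n.Partition * x ^ n ≤ Real.exp (x / (1 - x) / (1 - x)) := by
  have hfactor : ∀ k ∈ Finset.Icc 1 n,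
      ∑ m ∈ Finset.range (n + 1), (x ^ k) ^ m ≤ Real.exp (x ^ k / (1 - x)) := fun k hk =>
    geom_sum_range_le_exp (pow_nonneg hx k)
      (pow_le_of_le_one hx hx'.le (Nat.one_le_iff_ne_zero.1 (Finset.mem_Icc.1 hk).1)) hx' _
  have hsum : ∑ k ∈ Finset.Icc 1 n, x ^ k ≤ x / (1 - x) := by
    simpa only [pow_one, Finset.Ico_add_one_right_eq_Icc] using
      geom_sum_Ico_le_of_lt_one (m := 1) (n := n + 1) hx hx'
  calc Fintype.card n.Partition * x ^ n
      ≤ ∏ k ∈ Finset.Icc 1 n, ∑ m ∈ Finset.range (n + 1), (x ^ k) ^ m :=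
        card_partition_mul_pow_le_prod n hx
    _ ≤ ∏ k ∈ Finset.Icc 1 n, Real.exp (x ^ k / (1 - x)) :=
        Finset.prod_le_prod (fun _ _ => Finset.sum_nonneg fun _ _ => by positivity) hfactor
    _ = Real.exp ((∑ k ∈ Finset.Icc 1 n, x ^ k) / (1 - x)) := by
        rw [← Real.exp_sum, Finset.sum_div]
    _ ≤ Real.exp (x / (1 - x) / (1 - x)) :=
        Real.exp_le_exp.2 (div_le_div_of_nonneg_right hsum (sub_pos.2 hx').le)

theorem card_partition_isBigO {s : ℝ} (hs : 1 < s) :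
    (fun n : ℕ => (Fintype.card n.Partition : ℝ)) =O[atTop] fun n => s ^ n := by
  have hs0 : 0 < s := one_pos.trans hs
  refine .of_bound (Real.exp (s⁻¹ / (1 - s⁻¹) / (1 - s⁻¹))) (Eventually.of_forall fun n => ?_)
  have hle := card_partition_mul_pow_le n (inv_nonneg.2 hs0.le) (inv_lt_one_of_one_lt₀ hs)
  rw [inv_pow, ← div_eq_mul_inv, div_le_iff₀ (pow_pos hs0 n)] at hle
  rw [Real.norm_of_nonneg (Nat.cast_nonneg _), Real.norm_of_nonneg (by positivity)]
  exact hle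

theorem linear_pow_isBigO (a : ℕ) {t : ℝ} (ht : 1 < t) :
    (fun d : ℕ => (2 * d + a : ℝ) ^ a) =O[atTop] fun d => t ^ d := by
  have hlinear : (fun d : ℕ => (2 * d + a : ℝ)) =O[atTop] fun d => (d : ℝ) := by
    refine .of_bound (2 + a) ((eventually_ge_atTop 1).mono fun d hd => ?_)
    have hd' : (1 : ℝ) ≤ d := Nat.one_le_cast.2 hd
    rw [Real.norm_of_nonneg (by positivity), Real.norm_of_nonneg (by positivity), add_mul]
    gcongr
    exact le_mul_of_one_le_right (Nat.cast_nonneg a) hd'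
  exact (hlinear.pow a).trans (isLittleO_pow_const_const_pow_of_one_lt a ht).isBigO

theorem summable_card_partition_mul_pow_div (a : ℕ) {q : ℝ} (hq : 1 < q) :
    Summable fun d : ℕ => (Fintype.card d.Partition : ℝ) * (2 * d + a) ^ a / q ^ d := by
  obtain ⟨s, hs, hsq⟩ := exists_between hq
  have hs0 : 0 < s := one_pos.trans hs
  obtain ⟨t, ht, htq⟩ := exists_between ((one_lt_div hs0).2 hsq)
  have hq0 : 0 < q := one_pos.trans hq
  have hratio : s * t / q < 1 := (div_lt_one hq0).2 (by rwa [mul_comm, ← lt_div_iff₀ hs0])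
  have hgeom : Summable fun d : ℕ => (s * t / q) ^ d :=
    summable_geometric_of_lt_one (by positivity) hratio
  refine summable_of_isBigO_nat hgeom ?_
  simp_rw [div_pow, mul_pow, div_eq_mul_inv]
  exact ((card_partition_isBigO hs).mul (linear_pow_isBigO a ht)).mul
    (Asymptotics.isBigO_refl _ _)

end PartitionGrowth

namespace ArnoldAlgebra

section Edges

variable (K : Type*) {V W : Type*} [CommRing K]

open Classical in
/-- The class of `a_{i,j}` in the Arnold algebra, with the convention `a_{i,i} = 0`. -/
noncomputable def edge (i j : V) : ArnoldAlgebra K V :=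
  if h : i ≠ j then mk K (ArnoldExterior.gen K i j h) else 0

theorem edge_of_ne {i j : V} (h : i ≠ j) : edge K i j = mk K (ArnoldExterior.gen K i j h) :=
  dif_pos h

@[simp] theorem edge_self (i : V) : edge K i i = 0 := dif_neg (not_not_intro rfl)

theorem edge_symm (i j : V) : edge K i j = edge K j i := by
  obtain rfl | h := eq_or_ne i j
  · rfl
  · simp only [edge_of_ne K h, edge_of_ne K h.symm, ArnoldExterior.gen, Sym2.eq_swap]

theorem edge_anticomm (i j k l : V) : edge K i j * edge K k l = -(edge K k l * edge K i j) := by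
  obtain rfl | h := eq_or_ne i j
  · simp
  obtain rfl | h' := eq_or_ne k l
  · simp
  rw [edge_of_ne K h, edge_of_ne K h', ← map_mul, ← map_mul, ← map_neg]
  exact congrArg (mk K) (eq_neg_of_add_eq_zero_left (ExteriorAlgebra.ι_add_mul_swap _ _))

theorem edge_mul_self (i j : V) : edge K i j * edge K i j = 0 := by
  obtain rfl | h := eq_or_ne i j
  · simp
  rw [edge_of_ne K h, ← map_mul, ArnoldExterior.gen, ExteriorAlgebra.ι_sq_zero, map_zero]

theorem edge_arnold (i j k : V) :
    edge K i j * edge K j k + edge K j k * edge K k i + edge K k i * edge K i j = 0 := by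
  obtain rfl | hij := eq_or_ne i j
  · simp [edge_symm K k i, edge_mul_self]
  obtain rfl | hjk := eq_or_ne j k
  · simp [edge_symm K j i, edge_mul_self]
  obtain rfl | hki := eq_or_ne k i
  · simp [edge_symm K j k, edge_mul_self]
  simp only [edge_of_ne K hij, edge_of_ne K hjk, edge_of_ne K hki, ← map_mul, ← map_add]
  exact (RingQuot.mkAlgHom_rel K (.arnold i j k hij hjk hki)).trans (map_zero _)

theorem edge_mul_edge_same (i x y : V) :
    edge K i x * edge K i y = edge K i x * edge K x y - edge K i y * edge K x y := by
  have h := edge_arnold K i x y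
  rw [edge_symm K y i, edge_anticomm K i y i x, edge_anticomm K x y i y] at h
  rw [← sub_eq_zero, ← neg_eq_zero, ← h]
  abel

theorem algHom_ext {B : Type*} [Semiring B] [Algebra K B] {f g : ArnoldAlgebra K V →ₐ[K] B}
    (h : ∀ i j, f (edge K i j) = g (edge K i j)) : f = g := by
  refine RingQuot.ringQuot_ext' _ _ _ (ExteriorAlgebra.hom_ext (Finsupp.lhom_ext' ?_))
  rintro ⟨e, he⟩
  induction e using Sym2.ind with
  | _ i j =>
    have hij := h i j
    rw [edge_of_ne K fun hij => he (Sym2.mk_isDiag_iff.2 hij)] at hij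
    exact LinearMap.ext_ring hij

/-- The map of exterior algebras with `a_{i,j} ↦ a_{g i, g j}`, for an embedding `g` of the
vertices. -/
noncomputable def mapExterior (g : V ↪ W) : ArnoldExterior K V →ₐ[K] ArnoldExterior K W :=
  ExteriorAlgebra.map (Finsupp.lmapDomain K K fun e : ArnoldPair V =>
    (⟨Sym2.map g e.1, fun h => e.2 ((Sym2.isDiag_map g.injective).1 h)⟩ : ArnoldPair W))

theorem mapExterior_gen (g : V ↪ W) (i j : V) (h : i ≠ j) :
    mapExterior K g (ArnoldExterior.gen K i j h)
      = ArnoldExterior.gen K (g i) (g j) (g.injective.ne h) := by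
  simp [mapExterior, ArnoldExterior.gen, Finsupp.mapDomain_single]

/-- The map of Arnold algebras with `a_{i,j} ↦ a_{g i, g j}`, for an embedding `g` of the
vertices. -/
noncomputable def mapHom (g : V ↪ W) : ArnoldAlgebra K V →ₐ[K] ArnoldAlgebra K W :=
  RingQuot.liftAlgHom K ⟨(mk K).comp (mapExterior K g), by
    rintro _ _ ⟨i, j, k, hij, hjk, hki⟩
    simp only [AlgHom.comp_apply, map_add, map_mul, mapExterior_gen, map_zero, ← edge_of_ne]
    exact edge_arnold K (g i) (g j) (g k)⟩

theorem mapHom_mk (g : V ↪ W) (x : ArnoldExterior K V) :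
    mapHom K g (mk K x) = mk K (mapExterior K g x) :=
  RingQuot.liftAlgHom_mkAlgHom_apply K _ _ x

@[simp] theorem mapHom_edge (g : V ↪ W) (i j : V) :
    mapHom K g (edge K i j) = edge K (g i) (g j) := by
  obtain rfl | h := eq_or_ne i j
  · simp
  rw [edge_of_ne K h, edge_of_ne K (g.injective.ne h), ← mapExterior_gen, mapHom_mk]

@[simp] theorem permHom_edge (σ : Equiv.Perm V) (i j : V) :
    permHom K σ (edge K i j) = edge K (σ i) (σ j) :=
  mapHom_edge K σ.toEmbedding i j

theorem mapHom_permHom (g : V ↪ W) (σ : Equiv.Perm V) (x : ArnoldAlgebra K V) :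
    mapHom K g (permHom K σ x) = permHom K (σ.viaEmbedding g) (mapHom K g x) :=
  AlgHom.congr_fun (algHom_ext K (f := (mapHom K g).comp (permHom K σ))
    (g := (permHom K (σ.viaEmbedding g)).comp (mapHom K g))
    fun i j => by simp [Equiv.Perm.viaEmbedding_apply]) x

end Edges

section Monomials

variable (K : Type*) {V W : Type*} [CommRing K]

theorem piece_eq_span_edge_pow (d : ℕ) :
    piece K V d = Submodule.span K (Set.range fun e : V × V => edge K e.1 e.2) ^ d := by
  rw [piece, ExteriorAlgebra.exteriorPower, Submodule.map_pow]
  congr 1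
  rw [LinearMap.range_eq_map, ← (Finsupp.basisSingleOne (R := K) (ι := ArnoldPair V)).span_eq,
    Submodule.map_span, Submodule.map_span]
  refine le_antisymm (Submodule.span_le.2 ?_) (Submodule.span_le.2 ?_)
  · rintro _ ⟨_, ⟨_, ⟨⟨e, he⟩, rfl⟩, rfl⟩, rfl⟩
    induction e using Sym2.ind with
    | _ i j =>
      exact Submodule.subset_span
        ⟨(i, j), edge_of_ne K fun hij => he (Sym2.mk_isDiag_iff.2 hij)⟩
  · rintro _ ⟨⟨i, j⟩, rfl⟩
    obtain rfl | h := eq_or_ne i j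
    · simp
    · exact Submodule.subset_span
        ⟨_, ⟨_, ⟨⟨s(i, j), fun hd => h (Sym2.mk_isDiag_iff.1 hd)⟩, rfl⟩, rfl⟩,
          (edge_of_ne K h).symm⟩

/-- The monomial `a_{s 0, t 0} ⋯ a_{s (d - 1), t (d - 1)}`. -/
noncomputable def monomial {d : ℕ} (s t : Fin d → V) : ArnoldAlgebra K V :=
  (List.ofFn fun i => edge K (s i) (t i)).prod

theorem span_range_monomial (V : Type*) (d : ℕ) :
    Submodule.span K (Set.range fun p : (Fin d → V) × (Fin d → V) => monomial K p.1 p.2)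
      = piece K V d := by
  rw [piece_eq_span_edge_pow, Submodule.span_pow]
  congr 1
  ext z
  rw [Set.mem_pow]
  constructor
  · rintro ⟨⟨s, t⟩, rfl⟩
    exact ⟨fun i => ⟨_, (s i, t i), rfl⟩, rfl⟩
  · rintro ⟨f, rfl⟩
    choose e he using fun i => (f i).2
    exact ⟨(fun i => (e i).1, fun i => (e i).2), by simp [monomial, he]⟩

theorem mapHom_monomial (g : V ↪ W) {d : ℕ} (s t : Fin d → V) :
    mapHom K g (monomial K s t) = monomial K (g ∘ s) (g ∘ t) := by
  simp only [monomial, map_list_prod, List.map_ofFn, Function.comp_def, mapHom_edge]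

theorem permHom_monomial (σ : Equiv.Perm V) {d : ℕ} (s t : Fin d → V) :
    permHom K σ (monomial K s t) = monomial K (σ ∘ s) (σ ∘ t) :=
  mapHom_monomial K σ.toEmbedding s t

theorem monomial_mem_piece {d : ℕ} (s t : Fin d → V) : monomial K s t ∈ piece K V d :=
  span_range_monomial K V d ▸ Submodule.subset_span ⟨(s, t), rfl⟩

theorem mapHom_mem_piece (g : V ↪ W) {d : ℕ} {x : ArnoldAlgebra K V} (hx : x ∈ piece K V d) :
    mapHom K g x ∈ piece K W d := by
  suffices h : (piece K V d).map (mapHom K g).toLinearMap ≤ piece K W d from h ⟨x, hx, rfl⟩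
  rw [← span_range_monomial K V d, Submodule.map_span, Submodule.span_le]
  rintro _ ⟨_, ⟨⟨s, t⟩, rfl⟩, rfl⟩
  exact mapHom_monomial K g s t ▸ monomial_mem_piece K _ _

/-- The restriction of `mapHom` to the graded pieces. -/
noncomputable def pieceMap (g : V ↪ W) (d : ℕ) : piece K V d →ₗ[K] piece K W d :=
  (mapHom K g).toLinearMap.restrict fun _ => mapHom_mem_piece K g

theorem pieceMap_pieceRep (g : V ↪ W) (d : ℕ) (σ : Equiv.Perm V) (x : piece K V d) :
    pieceMap K g d (pieceRep K V d σ x) = pieceRep K W d (σ.viaEmbedding g) (pieceMap K g d x) :=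
  Subtype.ext (mapHom_permHom K g σ x)

instance finite_piece [Finite V] (d : ℕ) : Module.Finite K (piece K V d) := by
  rw [← span_range_monomial]
  exact Module.Finite.span_of_finite K (Set.finite_range _)

end Monomials

end ArnoldAlgebra

namespace ArnoldAlgebra

section Paths

variable (K : Type*) {V : Type*} [CommRing K]

/-- The product of the edges of the path with the given list of vertices. -/
noncomputable def path : List V → ArnoldAlgebra K V
  | [] => 1
  | [_] => 1
  | x :: y :: l => edge K x y * path (y :: l)

@[simp] theorem path_singleton (x : V) : path K [x] = 1 := rfl

@[simp] theorem path_cons_cons (x y : V) (l : List V) :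
    path K (x :: y :: l) = edge K x y * path K (y :: l) := rfl

/-- The span of the paths that start at `i` and then visit the vertices of `l` in any order. -/
noncomputable def rootedPaths (i : V) (l : List V) : Submodule K (ArnoldAlgebra K V) :=
  Submodule.span K {z | ∃ l', l'.Perm l ∧ path K (i :: l') = z}

variable {K}

theorem path_mem_rootedPaths {i : V} {l l' : List V} (h : l'.Perm l) :
    path K (i :: l') ∈ rootedPaths K i l :=
  Submodule.subset_span ⟨l', h, rfl⟩

theorem rootedPaths_congr (i : V) {l l' : List V} (h : l.Perm l') :
    rootedPaths K i l = rootedPaths K i l' := by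
  simp only [rootedPaths, h.congr_right]

theorem edge_mul_mem_rootedPaths_cons (i : V) {j : V} {l : List V} {w : ArnoldAlgebra K V}
    (hw : w ∈ rootedPaths K j l) : edge K i j * w ∈ rootedPaths K i (j :: l) := by
  suffices h : rootedPaths K j l ≤ (rootedPaths K i (j :: l)).comap
    (LinearMap.mulLeft K (edge K i j)) from h hw
  refine Submodule.span_le.2 ?_
  rintro _ ⟨l', hl', rfl⟩
  exact path_mem_rootedPaths (hl'.cons j)

theorem edge_mul_path_mem_rootedPaths (x : V) {y i : V} {l : List V} (hy : y ∈ i :: l) :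
    edge K x y * path K (i :: l) ∈ rootedPaths K i (x :: l) := by
  induction l generalizing y i with
  | nil =>
    obtain rfl := List.mem_singleton.1 hy
    rw [edge_symm]
    exact path_mem_rootedPaths (.refl [x])
  | cons z l ih =>
    have hattach : ∀ y ∈ z :: l, edge K i z * (edge K x y * path K (z :: l))
        ∈ rootedPaths K i (x :: z :: l) := fun y hy => by
      rw [rootedPaths_congr i (.swap z x l)]
      exact edge_mul_mem_rootedPaths_cons i (ih hy)
    obtain rfl | hy := List.mem_cons.1 hy
    · rw [path_cons_cons, ← mul_assoc, edge_symm, edge_mul_edge_same, sub_mul, mul_assoc, mul_assoc]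
      exact Submodule.sub_mem _ (path_mem_rootedPaths (.refl _)) (hattach z List.mem_cons_self)
    · rw [path_cons_cons, ← mul_assoc, edge_anticomm, neg_mul, mul_assoc]
      exact Submodule.neg_mem _ (hattach y hy)

theorem edge_mul_mem_rootedPaths (x : V) {y i : V} {l : List V} (hy : y ∈ i :: l)
    {w : ArnoldAlgebra K V} (hw : w ∈ rootedPaths K i l) :
    edge K x y * w ∈ rootedPaths K i (x :: l) := by
  suffices h : rootedPaths K i l ≤ (rootedPaths K i (x :: l)).comap
    (LinearMap.mulLeft K (edge K x y)) from h hw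
  refine Submodule.span_le.2 ?_
  rintro _ ⟨l', hl', rfl⟩
  rw [← rootedPaths_congr i (hl'.cons x)]
  exact edge_mul_path_mem_rootedPaths x ((hl'.cons i).mem_iff.2 hy)

theorem path_mem_rootedPaths_of_perm {y : V} {l m : List V} (h : l.Perm (y :: m)) :
    path K l ∈ rootedPaths K y m := by
  induction l generalizing m with
  | nil => exact absurd h.length_eq (by simp)
  | cons i l ih =>
    obtain rfl | hiy := eq_or_ne i y
    · exact path_mem_rootedPaths h.cons_inv
    classical
    have him : i ∈ m := (List.mem_cons.1 (h.mem_iff.1 List.mem_cons_self)).resolve_left hiy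
    have hl : l.Perm (y :: m.erase i) :=
      (h.trans (((List.perm_cons_erase him).cons y).trans (.swap i y _))).cons_inv
    obtain ⟨z, l, rfl⟩ := List.exists_cons_of_ne_nil (l := l)
      (List.ne_nil_of_mem (hl.mem_iff.2 List.mem_cons_self))
    rw [rootedPaths_congr y (List.perm_cons_erase him)]
    exact edge_mul_mem_rootedPaths i (hl.mem_iff.1 List.mem_cons_self) (ih hl)

theorem edge_mul_path_cons_eq_zero {x y : V} {l : List V} (hy : y ∈ l) :
    edge K x y * path K (x :: l) = 0 := by
  induction l generalizing x with
  | nil => exact absurd hy List.not_mem_nil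
  | cons z l ih =>
    rw [path_cons_cons, ← mul_assoc]
    obtain rfl | hy := List.mem_cons.1 hy
    · rw [edge_mul_self, zero_mul]
    · have hz : edge K y z * path K (z :: l) = 0 := by rw [edge_symm, ih hy]
      rw [edge_mul_edge_same, sub_mul, mul_assoc, mul_assoc, hz, mul_zero, mul_zero, sub_zero]

theorem edge_mul_path_eq_zero {x y : V} {l : List V} (hx : x ∈ l) (hy : y ∈ l) :
    edge K x y * path K l = 0 := by
  classical
  obtain rfl | hxy := eq_or_ne y x
  · rw [edge_self, zero_mul]
  have hyl : y ∈ l.erase x := (List.mem_erase_of_ne hxy).2 hy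
  suffices h : rootedPaths K x (l.erase x) ≤ LinearMap.ker (LinearMap.mulLeft K (edge K x y)) from
    h (path_mem_rootedPaths_of_perm (List.perm_cons_erase hx))
  refine Submodule.span_le.2 ?_
  rintro _ ⟨l', hl', rfl⟩
  exact edge_mul_path_cons_eq_zero (hl'.mem_iff.2 hyl)

theorem span_singleton_mul_eq {A : Type*} [Semiring A] [Algebra K A] (a b : A) :
    Submodule.span K {a * b} = Submodule.span K {a} * Submodule.span K {b} := by
  rw [Submodule.span_mul_span, Set.singleton_mul_singleton]

theorem commute_span_edge_edge (i j k l : V) :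
    Commute (Submodule.span K {edge K i j}) (Submodule.span K {edge K k l}) := by
  rw [commute_iff_eq, ← span_singleton_mul_eq, ← span_singleton_mul_eq, edge_anticomm,
    ← Set.neg_singleton, Submodule.span_neg]

theorem commute_span_path {S : Submodule K (ArnoldAlgebra K V)}
    (hS : ∀ i j, Commute S (Submodule.span K {edge K i j})) :
    ∀ l, Commute S (Submodule.span K {path K l})
  | [] | [_] => by
    rw [path, ← Submodule.one_eq_span]
    exact Commute.one_right S
  | x :: y :: l => by
    rw [path_cons_cons, span_singleton_mul_eq]
    exact (hS x y).mul_right (commute_span_path hS (y :: l))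

theorem commute_span_edge_path (x y : V) (l : List V) :
    Commute (Submodule.span K {edge K x y}) (Submodule.span K {path K l}) :=
  commute_span_path (commute_span_edge_edge x y) l

theorem commute_span_path_path (l l' : List V) :
    Commute (Submodule.span K {path K l}) (Submodule.span K {path K l'}) :=
  commute_span_path (fun x y => (commute_span_edge_path x y l).symm) l'

theorem path_mul_mem_rootedPaths {i y : V} {l m : List V} (hy : y ∈ i :: l)
    {w : ArnoldAlgebra K V} (hw : w ∈ rootedPaths K i l) :
    path K (y :: m) * w ∈ rootedPaths K i (m ++ l) := by
  induction m generalizing y l w with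
  | nil => rwa [path_singleton, one_mul]
  | cons z m ih =>
    have hcomm : edge K y z * path K (z :: m)
        ∈ Submodule.span K {path K (z :: m) * edge K z y} := by
      rw [span_singleton_mul_eq, edge_symm K z y, ← (commute_span_edge_path y z (z :: m)).eq,
        ← span_singleton_mul_eq]
      exact Submodule.mem_span_singleton_self _
    obtain ⟨c, hc⟩ := Submodule.mem_span_singleton.1 hcomm
    rw [path_cons_cons, ← hc, smul_mul_assoc, mul_assoc, List.cons_append,
      ← rootedPaths_congr i (List.perm_middle (a := z) (l₁ := m) (l₂ := l))]
    exact Submodule.smul_mem _ c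
      (ih (List.mem_cons_of_mem i List.mem_cons_self) (edge_mul_mem_rootedPaths z hy hw))

open scoped List in
theorem path_mul_edge_mul_path_mem_span {x y : V} {l l' : List V} (hx : x ∈ l) (hy : y ∈ l') :
    path K l' * (edge K x y * path K l)
      ∈ Submodule.span K {z | ∃ m, m.Perm (l ++ l') ∧ path K m = z} := by
  classical
  have hattach : edge K x y * path K l ∈ rootedPaths K x (y :: l.erase x) := by
    rw [edge_symm]
    exact edge_mul_mem_rootedPaths y List.mem_cons_self
      (path_mem_rootedPaths_of_perm (List.perm_cons_erase hx))
  suffices h : rootedPaths K y (l'.erase y) ≤ (Submodule.span K {z | ∃ m, m.Perm (l ++ l') ∧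
      path K m = z}).comap (LinearMap.mulRight K (edge K x y * path K l)) from
    h (path_mem_rootedPaths_of_perm (List.perm_cons_erase hy))
  refine Submodule.span_le.2 ?_
  rintro _ ⟨m, hm, rfl⟩
  refine Submodule.span_mono ?_
    (path_mul_mem_rootedPaths (m := m) (List.mem_cons_of_mem x List.mem_cons_self) hattach)
  rintro _ ⟨m', hm', rfl⟩
  refine ⟨x :: m', ?_, rfl⟩
  calc x :: m'
    _ ~ x :: (m ++ y :: l.erase x) := hm'.cons x
    _ ~ x :: (y :: m ++ l.erase x) := List.perm_middle.cons x
    _ ~ x :: (l' ++ l.erase x) :=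
      (((hm.cons y).trans (List.perm_cons_erase hy).symm).append_right _).cons x
    _ ~ l' ++ x :: l.erase x := List.perm_middle.symm
    _ ~ l' ++ l := (List.perm_cons_erase hx).symm.append_left l'
    _ ~ l ++ l' := List.perm_append_comm

end Paths

section Forests

variable (K : Type*) {V : Type*} [CommRing K]

/-- The product of the edges of a disjoint union of paths. -/
noncomputable def forest (L : List (List V)) : ArnoldAlgebra K V := (L.map (path K)).prod

@[simp] theorem forest_cons (l : List V) (L : List (List V)) :
    forest K (l :: L) = path K l * forest K L := by
  rw [forest, List.map_cons, List.prod_cons, forest]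

/-- The lists `L` of nonempty paths that partition the vertices `T` and have `d` edges in total. -/
structure IsForest (T : List V) (d : ℕ) (L : List (List V)) : Prop where
  flatten_perm : L.flatten.Perm T
  ne_nil : ∀ l ∈ L, l ≠ []
  length_add : L.length + d = T.length

theorem span_forest_eq_prod (L : List (List V)) :
    Submodule.span K {forest K L} = (L.map fun l => Submodule.span K {path K l}).prod := by
  induction L with
  | nil => exact Submodule.one_eq_span.symm
  | cons l L ih => rw [forest_cons, span_singleton_mul_eq, ih, List.map_cons, List.prod_cons]

theorem span_forest_congr {L L' : List (List V)} (h : L.Perm L') :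
    Submodule.span K {forest K L} = Submodule.span K {forest K L'} := by
  rw [span_forest_eq_prod, span_forest_eq_prod]
  exact (h.map _).prod_eq' (List.pairwise_map.2 (List.pairwise_of_forall
    fun l l' => commute_span_path_path l l'))

variable {T : List V} {d : ℕ}

theorem IsForest.perm {L L' : List (List V)} (hL : IsForest T d L) (h : L.Perm L') :
    IsForest T d L' where
  flatten_perm := h.symm.flatten.trans hL.flatten_perm
  ne_nil l hl := hL.ne_nil l (h.mem_iff.2 hl)
  length_add := h.length_eq ▸ hL.length_add

theorem IsForest.join {l l' m : List V} {L : List (List V)} (hL : IsForest T d (l :: l' :: L))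
    (hm : m.Perm (l ++ l')) : IsForest T (d + 1) (m :: L) where
  flatten_perm := by
    rw [List.flatten_cons]
    refine (hm.append_right _).trans ?_
    rw [List.append_assoc]
    exact hL.flatten_perm
  ne_nil := List.forall_mem_cons.2
    ⟨fun h => hL.ne_nil l List.mem_cons_self (List.append_eq_nil_iff.1 (h ▸ hm).nil_eq.symm).1,
      fun p hp => hL.ne_nil p (List.mem_cons_of_mem l (List.mem_cons_of_mem l' hp))⟩
  length_add := by
    have := hL.length_add
    simp only [List.length_cons] at this ⊢
    lia

/-- The span of the forests with `d` edges on the vertices `T`. -/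
noncomputable def forestSpan (T : List V) (d : ℕ) : Submodule K (ArnoldAlgebra K V) :=
  Submodule.span K {z | ∃ L, IsForest T d L ∧ forest K L = z}

variable {K}

theorem edge_mul_forest_mem_of_join {x y : V} {l l' : List V} {L : List (List V)}
    (hL : IsForest T d (l :: l' :: L)) (hx : x ∈ l) (hy : y ∈ l') :
    edge K x y * forest K (l :: l' :: L) ∈ forestSpan K T (d + 1) := by
  have hspan : Submodule.span K {edge K x y * forest K (l :: l' :: L)}
      = Submodule.span K {path K l' * (edge K x y * path K l)} * Submodule.span K {forest K L} := by
    simp only [forest_cons, span_singleton_mul_eq]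
    rw [← mul_assoc (Submodule.span K {path K l}), (commute_span_path_path l l').eq,
      mul_assoc (Submodule.span K {path K l'}), ← mul_assoc,
      (commute_span_edge_path x y l').eq, mul_assoc, mul_assoc, mul_assoc]
  suffices h : Submodule.span K {path K l' * (edge K x y * path K l)}
      * Submodule.span K {forest K L} ≤ forestSpan K T (d + 1) from
    h (hspan ▸ Submodule.mem_span_singleton_self _)
  refine (mul_le_mul' ((Submodule.span_singleton_le_iff_mem _ _).2
    (path_mul_edge_mul_path_mem_span hx hy)) le_rfl).trans ?_
  rw [Submodule.span_mul_span, Submodule.span_le]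
  rintro _ ⟨_, ⟨m, hm, rfl⟩, _, rfl, rfl⟩
  exact Submodule.subset_span ⟨m :: L, hL.join hm, forest_cons K m L⟩

theorem edge_mul_forest_mem {x y : V} {L : List (List V)} (hL : IsForest T d L) (hx : x ∈ T)
    (hy : y ∈ T) : edge K x y * forest K L ∈ forestSpan K T (d + 1) := by
  classical
  obtain ⟨l, hl, hxl⟩ := List.mem_flatten.1 (hL.flatten_perm.mem_iff.2 hx)
  obtain ⟨l', hl', hyl'⟩ := List.mem_flatten.1 (hL.flatten_perm.mem_iff.2 hy)
  have hreorder : ∀ {L'}, L.Perm L' → edge K x y * forest K L' ∈ forestSpan K T (d + 1) →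
      edge K x y * forest K L ∈ forestSpan K T (d + 1) := by
    intro L' h hmem
    obtain ⟨c, hc⟩ := Submodule.mem_span_singleton.1
      (span_forest_congr K h ▸ Submodule.mem_span_singleton_self (forest K L))
    rw [← hc, mul_smul_comm]
    exact Submodule.smul_mem _ c hmem
  have hperm := List.perm_cons_erase hl
  by_cases hyl : y ∈ l
  · refine hreorder hperm ?_
    rw [forest_cons, ← mul_assoc, edge_mul_path_eq_zero hxl hyl, zero_mul]
    exact Submodule.zero_mem _
  · have hne : l' ≠ l := fun h => hyl (h ▸ hyl')
    have hperm' := hperm.trans ((List.perm_cons_erase ((List.mem_erase_of_ne hne).2 hl')).cons l)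
    exact hreorder hperm' (edge_mul_forest_mem_of_join (hL.perm hperm') hxl hyl')

theorem one_mem_forestSpan (T : List V) : 1 ∈ forestSpan K T 0 :=
  Submodule.subset_span ⟨T.map fun v => [v], ⟨by simp [← List.flatMap_def], by simp, by simp⟩, by
    simp [forest, Function.comp_def]⟩

theorem piece_le_forestSpan (hT : ∀ v, v ∈ T) (d : ℕ) : piece K V d ≤ forestSpan K T d := by
  rw [piece_eq_span_edge_pow]
  induction d with
  | zero =>
    rw [pow_zero, Submodule.one_le]
    exact one_mem_forestSpan T
  | succ d ih =>
    rw [pow_succ']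
    refine (mul_le_mul' le_rfl ih).trans ?_
    rw [forestSpan, Submodule.span_mul_span, Submodule.span_le]
    rintro _ ⟨_, ⟨⟨x, y⟩, rfl⟩, _, ⟨L, hL, rfl⟩, rfl⟩
    exact edge_mul_forest_mem hL (hT x) (hT y)

end Forests

end ArnoldAlgebra

theorem multiset_eq_of_filter_ne_zero_eq {M : Type*} [Zero M] [DecidableEq M] {s t : Multiset M}
    (hcard : s.card = t.card) (h : s.filter (· ≠ 0) = t.filter (· ≠ 0)) : s = t := by
  rw [← Multiset.filter_add_not (· ≠ 0) s, ← Multiset.filter_add_not (· ≠ 0) t] at hcard ⊢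
  simp_all [Multiset.filter_eq']

namespace ArnoldAlgebra

section ForestTypes

variable {K V : Type*} [CommRing K]

theorem one_mem_piece : (1 : ArnoldAlgebra K V) ∈ piece K V 0 := by
  rw [piece_eq_span_edge_pow, pow_zero]
  exact Submodule.one_le.1 (le_refl (1 : Submodule K (ArnoldAlgebra K V)))

theorem mul_mem_piece {d d' : ℕ} {x y : ArnoldAlgebra K V} (hx : x ∈ piece K V d)
    (hy : y ∈ piece K V d') : x * y ∈ piece K V (d + d') := by
  rw [piece_eq_span_edge_pow] at hx hy ⊢
  rw [pow_add]
  exact Submodule.mul_mem_mul hx hy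

theorem edge_mem_piece (x y : V) : edge K x y ∈ piece K V 1 := by
  rw [piece_eq_span_edge_pow, pow_one]
  exact Submodule.subset_span ⟨(x, y), rfl⟩

theorem path_mem_piece : ∀ l : List V, path K l ∈ piece K V (l.length - 1)
  | [] | [_] => one_mem_piece
  | x :: y :: l => by
    rw [path_cons_cons, List.length_cons, Nat.add_sub_cancel, List.length_cons, add_comm]
    exact mul_mem_piece (edge_mem_piece x y) (path_mem_piece (y :: l))

theorem forest_mem_piece (L : List (List V)) :
    forest K L ∈ piece K V (L.map fun l => l.length - 1).sum := by
  induction L with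
  | nil => exact one_mem_piece
  | cons l L ih =>
    rw [forest_cons, List.map_cons, List.sum_cons]
    exact mul_mem_piece (path_mem_piece l) ih

theorem permHom_path (σ : Equiv.Perm V) :
    ∀ l : List V, permHom K σ (path K l) = path K (l.map σ)
  | [] | [_] => map_one _
  | x :: y :: l => by
    rw [path_cons_cons, map_mul, permHom_edge, permHom_path σ (y :: l)]
    rfl

theorem permHom_forest (σ : Equiv.Perm V) (L : List (List V)) :
    permHom K σ (forest K L) = forest K (L.map (List.map σ)) := by
  rw [forest, map_list_prod, List.map_map, forest, List.map_map]
  exact congrArg List.prod (List.map_congr_left fun l _ => permHom_path σ l)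

theorem exists_perm_forest_mem_span {L L' : List (List V)} (hL : L.flatten.Nodup)
    (hL' : L'.flatten.Nodup) (h : (L.map List.length).Perm (L'.map List.length)) :
    ∃ σ : Equiv.Perm V, forest K L' ∈ Submodule.span K {permHom K σ (forest K L)} := by
  obtain ⟨L₁, hlength, hperm⟩ := List.perm_comp_forall₂ (r := fun k l => k = List.length l)
    h.symm (List.forall₂_map_left_iff.2 (List.forall₂_same.2 fun _ _ => rfl))
  have hlength : L'.map List.length = L₁.map List.length := by
    rw [← List.forall₂_eq_eq_eq]
    exact List.forall₂_map_right_iff.2 hlength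
  obtain ⟨σ, hσ⟩ := exists_perm_map_eq (hperm.flatten.nodup_iff.2 hL) hL'
    (by rw [List.length_flatten, List.length_flatten, hlength])
  have hmap : L₁.map (List.map σ) = L' :=
    List.eq_iff_flatten_eq.2 ⟨by rw [← List.map_flatten, hσ], by simp [hlength, Function.comp_def]⟩
  refine ⟨σ, ?_⟩
  rw [permHom_forest, ← span_forest_congr K (hperm.map _), hmap]
  exact Submodule.mem_span_singleton_self _

variable {T : List V} {d : ℕ} {L L' : List (List V)}

theorem IsForest.map_length (h : IsForest T d L) :
    L.map List.length = (L.map fun l => l.length - 1).map (· + 1) := by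
  rw [List.map_map]
  exact List.map_congr_left fun l hl =>
    (Nat.sub_add_cancel (List.length_pos_iff.2 (h.ne_nil l hl))).symm

theorem IsForest.sum_length_sub_one (h : IsForest T d L) :
    (L.map fun l => l.length - 1).sum = d := by
  have hsum : L.flatten.length = (L.map fun l => l.length - 1).sum + L.length := by
    rw [List.length_flatten, h.map_length, List.sum_map_add, List.map_id']
    simp [Function.comp_def]
  have := h.length_add
  have := h.flatten_perm.length_eq
  lia

/-- The partition of `d` given by the numbers of edges of the paths of a forest with `d` edges. -/
def IsForest.partition (h : IsForest T d L) : d.Partition :=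
  .ofSums d (L.map fun l : List V => l.length - 1 : List ℕ) h.sum_length_sub_one

theorem IsForest.map_length_perm (h : IsForest T d L) (h' : IsForest T d L')
    (hpartition : h.partition = h'.partition) :
    (L.map List.length).Perm (L'.map List.length) := by
  rw [h.map_length, h'.map_length]
  refine List.Perm.map _ (Multiset.coe_eq_coe.1 (multiset_eq_of_filter_ne_zero_eq ?_
    (congrArg Nat.Partition.parts hpartition)))
  have := h.length_add.trans h'.length_add.symm
  simpa using this

/-- A forest with `d` edges as an element of the graded piece of degree `d`. -/
noncomputable def IsForest.toPiece (h : IsForest T d L) : piece K V d :=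
  ⟨forest K L, h.sum_length_sub_one ▸ forest_mem_piece L⟩

theorem span_range_toPiece (hT : ∀ v, v ∈ T) (d : ℕ) :
    Submodule.span K (Set.range fun L : {L // IsForest T d L} => L.2.toPiece (K := K)) = ⊤ := by
  refine (Submodule.span_range_subtype_eq_top_iff _ _).2 (le_antisymm ?_ ?_)
  · rw [Submodule.span_le]
    rintro _ ⟨L, rfl⟩
    exact (L.2.toPiece (K := K)).2
  · refine (piece_le_forestSpan hT d).trans (Submodule.span_mono ?_)
    rintro _ ⟨L, hL, rfl⟩
    exact ⟨⟨L, hL⟩, rfl⟩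

theorem IsForest.exists_toPiece_mem_span (h : IsForest T d L) (h' : IsForest T d L')
    (hT : T.Nodup) (hpartition : h.partition = h'.partition) :
    ∃ σ, h'.toPiece (K := K) ∈ Submodule.span K {pieceRep K V d σ h.toPiece} := by
  obtain ⟨σ, hσ⟩ := exists_perm_forest_mem_span (K := K) (h.flatten_perm.nodup_iff.2 hT)
    (h'.flatten_perm.nodup_iff.2 hT) (h.map_length_perm h' hpartition)
  obtain ⟨c, hc⟩ := Submodule.mem_span_singleton.1 hσ
  exact ⟨σ, Submodule.mem_span_singleton.2 ⟨c, Subtype.ext hc⟩⟩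

theorem finrank_tensorCoinvariants_piece_le (K : Type*) [CommRing K] [Nontrivial K]
    (V X : Type*) [Finite V] [Finite X] [MulAction (Equiv.Perm V) X] (d : ℕ) :
    Module.finrank K (TensorCoinvariants X (pieceRep K V d))
      ≤ Fintype.card d.Partition * Nat.card X := by
  have := Fintype.ofFinite V
  rw [← Nat.card_eq_fintype_card]
  exact finrank_tensorCoinvariants_le_of_type (pieceRep K V d)
    (span_range_toPiece (fun v => Finset.mem_toList.2 (Finset.mem_univ v)) d)
    (fun L => L.2.partition)
    fun L L' h => L.2.exists_toPiece_mem_span L'.2 (Finset.nodup_toList _) h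

end ForestTypes

end ArnoldAlgebra

namespace ArnoldAlgebra

section Stability

variable (K : Type*) {V W : Type*}

section CommRing

variable [CommRing K]

/-- The coinvariants of labelings `Y → V` tensored with the `d`-th graded piece of the Arnold
algebra of `V`. -/
abbrev LabelCoinvariants (Y V : Type*) (d : ℕ) : Type _ :=
  TensorCoinvariants (Y → V) (pieceRep K V d)

/-- The map on `LabelCoinvariants` induced by an embedding of the vertices. -/
noncomputable def labelMap (Y : Type*) (g : V ↪ W) (d : ℕ) :
    LabelCoinvariants K Y V d →ₗ[K] LabelCoinvariants K Y W d :=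
  tensorMap (postcomp Y g) (pieceMap K g d) (pieceMap_pieceRep K g d)

theorem labelMap_comp_relabel {Y : Type*} (g : V ↪ W) (d : ℕ) (c : Y → Y) :
    labelMap K Y g d ∘ₗ relabel (pieceRep K V d) (precomp V c)
      = relabel (pieceRep K W d) (precomp W c) ∘ₗ labelMap K Y g d :=
  tensorCoinvariants_hom_ext fun f x => by simp [labelMap, Function.comp_assoc]

theorem labelMap_surjective (Y : Type*) [Finite Y] [Finite V] (g : V ↪ W) (d : ℕ)
    (hcard : 2 * d + Nat.card Y ≤ Nat.card V) : Function.Surjective (labelMap K Y g d) := by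
  rw [← LinearMap.range_eq_top, eq_top_iff, ← iSup_range_tensorMk, iSup_le_iff]
  intro f
  have hspan : Submodule.span K (Set.range fun p : (Fin d → W) × (Fin d → W) =>
      (⟨monomial K p.1 p.2, monomial_mem_piece K p.1 p.2⟩ : piece K W d)) = ⊤ :=
    (Submodule.span_range_subtype_eq_top_iff _ _).2 (span_range_monomial K W d)
  rw [LinearMap.range_eq_map, ← hspan, Submodule.map_span, Submodule.span_le]
  rintro _ ⟨_, ⟨⟨s, t⟩, rfl⟩, rfl⟩
  obtain ⟨σ, h, hσ⟩ := exists_perm_comp_eq (Sum.elim f (Sum.elim s t)) g (by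
    simp only [Nat.card_sum, Nat.card_fin]
    lia)
  let x : piece K V d := ⟨_, monomial_mem_piece K (h ∘ .inr ∘ .inl) (h ∘ .inr ∘ .inr)⟩
  have hf : σ • postcomp Y g (h ∘ .inl) = f := by
    funext y
    exact congrFun hσ (.inl y)
  have hx : pieceRep K W d σ (pieceMap K g d x)
      = ⟨monomial K s t, monomial_mem_piece K s t⟩ := by
    refine Subtype.ext ((congrArg _ (mapHom_monomial K g _ _)).trans
      ((permHom_monomial K σ _ _).trans ?_))
    exact congrArg₂ (monomial K) (funext fun i => congrFun hσ (.inr (.inl i)))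
      (funext fun i => congrFun hσ (.inr (.inr i)))
  refine ⟨tensorMk _ (h ∘ .inl) x, ?_⟩
  rw [labelMap, tensorMap_tensorMk, ← tensorMk_smul _ σ, hf, hx]

end CommRing

variable [Field K]

/-- The trace of a permutation of the labels on `LabelCoinvariants`. -/
noncomputable def labelTrace {Y : Type*} (c : Y → Y) (d n : ℕ) : K :=
  LinearMap.trace K (LabelCoinvariants K Y (Fin n) d)
    (relabel (pieceRep K (Fin n) d) (precomp (Fin n) c))

theorem labelTrace_eq [CharZero K] {Y : Type*} [Finite Y] (c : Y → Y) (d n : ℕ) :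
    labelTrace K c d n = (Fintype.card (Equiv.Perm (Fin n)) : K)⁻¹
      * ∑ σ : Equiv.Perm (Fin n), labelFix c σ * (pieceRep K (Fin n) d).character σ :=
  trace_relabel (pieceRep K (Fin n) d) (precomp (Fin n) c)

theorem eventuallyConst_labelTrace {Y : Type*} [Finite Y] (c : Y → Y) (d : ℕ) :
    EventuallyConst (labelTrace K c d) atTop := by
  refine eventuallyConst_trace (Q := fun n => LabelCoinvariants K Y (Fin n) d)
    (T := fun n => relabel (pieceRep K (Fin n) d) (precomp (Fin n) c))
    (φ := fun n => labelMap K Y Fin.castSuccEmb d)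
    (fun n => labelMap_comp_relabel K Fin.castSuccEmb d c) ?_
  filter_upwards [eventually_ge_atTop (2 * d + Nat.card Y)] with n hn
  exact labelMap_surjective K Y _ d (by simpa using hn)

theorem finrank_labelCoinvariants_le (Y : Type*) [Finite Y] {d n : ℕ}
    (hn : 2 * d + Nat.card Y ≤ n) :
    Module.finrank K (LabelCoinvariants K Y (Fin n) d)
      ≤ Fintype.card d.Partition * (2 * d + Nat.card Y) ^ Nat.card Y := by
  have hsurj := labelMap_surjective K Y (Fin.castLEEmb hn) d (Nat.card_fin _).ge
  refine (LinearMap.finrank_le_finrank_of_surjective hsurj).trans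
    ((finrank_tensorCoinvariants_piece_le K _ _ d).trans ?_)
  rw [Nat.card_fun, Nat.card_fin]

theorem norm_labelTrace_le (K : Subfield ℂ) {Y : Type*} [Finite Y] (c : Equiv.Perm Y) {d n : ℕ}
    (hn : 2 * d + Nat.card Y ≤ n) :
    ‖(labelTrace K c d n : ℂ)‖
      ≤ Fintype.card d.Partition * (2 * d + Nat.card Y : ℝ) ^ Nat.card Y := by
  have hpow : relabel (pieceRep K (Fin n) d) (precomp (Fin n) c) ^ orderOf c = 1 := by
    refine relabel_pow_eq_one _ (funext fun f => ?_)
    rw [iterate_precomp, Equiv.Perm.iterate_eq_pow, pow_orderOf_eq_one]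
    rfl
  have hfinrank := finrank_labelCoinvariants_le K Y hn
  exact (norm_algebraMap_trace_le_finrank (orderOf_pos c).ne' hpow).trans (mod_cast hfinrank)

end Stability

end ArnoldAlgebra

section Pairing

variable (K : Subfield ℂ)

/-- The pairings `⟨F_n, A^d_n⟩` of a sequence of functions `F n` on the symmetric groups with the
characters of the graded pieces of the Arnold algebras, as a function of `d` and `n`. -/
noncomputable def arnoldPairing :
    (∀ n : ℕ, Equiv.Perm (Fin n) → K) →ₗ[K] (ℕ → ℕ → ℂ) where
  toFun F d n := classInner (fun σ => (F n σ : ℂ))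
    fun σ => (((ArnoldAlgebra.pieceRep K (Fin n) d).character σ : K) : ℂ)
  map_add' F G := by
    ext d n
    simp [classInner, add_mul, Finset.sum_add_distrib, mul_add]
  map_smul' a F := by
    ext d n
    simp [classInner, Subfield.smul_def, Finset.mul_sum, mul_assoc, mul_left_comm]

theorem arnoldPairing_labelFix {Y : Type*} [Finite Y] (c : Y → Y) (d n : ℕ) :
    arnoldPairing K (fun _ σ => (labelFix c σ : K)) d n
      = starRingEnd ℂ (ArnoldAlgebra.labelTrace K c d n : ℂ) := by
  simp [arnoldPairing, classInner, ArnoldAlgebra.labelTrace_eq]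

/-- The double sequences whose rows `u d` converge, to limits whose power series in `1 / q`
converges absolutely. -/
def summableRowLimits (q : ℂ) : Submodule ℂ (ℕ → ℕ → ℂ) where
  carrier := {u | ∃ L : ℕ → ℂ, (∀ d, Tendsto (u d) atTop (𝓝 (L d))) ∧
    Summable fun d => ‖L d / q ^ d‖}
  zero_mem' := ⟨0, fun _ => tendsto_const_nhds, by simp⟩
  add_mem' := by
    rintro u v ⟨L, hL, hLq⟩ ⟨M, hM, hMq⟩
    refine ⟨L + M, fun d => (hL d).add (hM d), ?_⟩
    simp only [Pi.add_apply, add_div]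
    exact (hLq.of_norm.add hMq.of_norm).norm
  smul_mem' := by
    rintro a u ⟨L, hL, hLq⟩
    refine ⟨a • L, fun d => (hL d).const_smul a, ?_⟩
    simp only [Pi.smul_apply, smul_eq_mul, mul_div_assoc]
    exact (hLq.of_norm.mul_left a).norm

theorem mem_summableRowLimits {q : ℂ} {u : ℕ → ℕ → ℂ} {B : ℕ → ℝ}
    (hconst : ∀ d, EventuallyConst (u d) atTop) (hB : ∀ d, ∀ᶠ n in atTop, ‖u d n‖ ≤ B d)
    (hsum : Summable fun d => B d / ‖q‖ ^ d) : u ∈ summableRowLimits q := by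
  choose L hL using fun d => eventuallyConst_iff_exists_eventuallyEq.1 (hconst d)
  refine ⟨L, fun d => tendsto_const_nhds.congr' (hL d).symm, ?_⟩
  refine hsum.of_nonneg_of_le (fun _ => norm_nonneg _) fun d => ?_
  obtain ⟨n, hn, hnB⟩ := ((hL d).and (hB d)).exists
  rw [norm_div, norm_pow]
  gcongr
  rwa [hn] at hnB

theorem arnoldPairing_labelFix_mem {q : ℂ} (hq : 1 < ‖q‖) {Y : Type*} [Finite Y]
    (c : Equiv.Perm Y) :
    arnoldPairing K (fun _ σ => (labelFix c σ : K)) ∈ summableRowLimits q := by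
  refine mem_summableRowLimits (fun d => ?_) (fun d => ?_)
    (summable_card_partition_mul_pow_div (Nat.card Y) hq)
  · rw [funext (arnoldPairing_labelFix K c d)]
    exact (ArnoldAlgebra.eventuallyConst_labelTrace K c d).comp fun x => starRingEnd ℂ (x : ℂ)
  · filter_upwards [eventually_ge_atTop (2 * d + Nat.card Y)] with n hn
    rw [arnoldPairing_labelFix, RCLike.norm_conj]
    exact ArnoldAlgebra.norm_labelTrace_le K c hn

end Pairing

theorem proposition3p5_general (K : Subfield ℂ) (q : ℂ) (hq : 1 < ‖q‖) (P : MvPolynomial ℕ+ K) :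
    ∃ L : ℕ → ℂ,
      (∀ d : ℕ, Tendsto (fun n : ℕ => arnoldInner K P d n) atTop (𝓝 (L d))) ∧
      Summable (fun d : ℕ => ‖L d / q ^ d‖) := by
  have hspan : labelSpan K
      ≤ ((summableRowLimits q).restrictScalars K).comap (arnoldPairing K) := by
    refine Submodule.span_le.2 ?_
    rintro _ ⟨⟨k, c⟩, rfl⟩
    exact arnoldPairing_labelFix_mem K hq c
  exact hspan (charPolyFun_mem_labelSpan K P)

theorem proposition3p5 (K : Subfield ℂ) (q : ℝ) (hq : 3 ≤ q) (P : MvPolynomial ℕ+ K) :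
    ∃ L : ℕ → ℂ,
      (∀ d : ℕ, Tendsto (fun n : ℕ => arnoldInner K P d n) atTop (𝓝 (L d))) ∧
      Summable (fun d : ℕ => ‖L d / (q : ℂ) ^ d‖) := by
  refine proposition3p5_general K q ?_ P
  rw [Complex.norm_real]
  exact (by linarith : 1 < q).trans_le (Real.le_norm_self q)
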